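/- Let $Z_1,Z_2,Z_3\in\mathbb R^2$ be the vertices of a nondegenerate triangle with $\|Z_1-Z_3\|=\|Z_2-Z_3\|$, let $d_1=d_2>0$ and $d_3>0$, and let $X$ be the set of global minimizers over $W\in\mathbb R^2$ of $$O(W)=\sum_{j=1}^3\bigl|\,\|W-Z_j\|^2-d_j^2\,\bigr| .$$ Let $S_{ij}$ be the intersection of the circles $\{\|W-Z_i\|=d_i\}$ and $\{\|W-Z_j\|=d_j\}$, and, if it is nonempty, let $S_{ij+}$ and $S_{ij-}$ be its point nearest to, respectively farthest from, the third sensor $Z_k$. Write $S_{ij\pm}$ for the two points $S_{ij+},S_{ij-}$. Put $r=\|Z_1-Z_2\|$, $s=\|Z_3-\tfrac{Z_1+Z_2}2\|$, $h=\sqrt{d_1^2-\tfrac{r^2}4}$ (for $d_1\ge r/2$), and $$R=\sqrt{h^2+s^2\tfrac{4s^2+r^2}{4s^2+9r^2}-2sh\tfrac{4s^2-3r^2}{4s^2+9r^2}},\qquad M=\sqrt{h^2+2sh\tfrac{4s^2-3r^2}{4s^2+r^2}+s^2\tfrac{4s^2+9r^2}{4s^2+r^2}},$$ $$P=\sqrt{\tfrac{r^2}4+s^2\bigl(\tfrac{4s^2+5r^2}{4s^2-3r^2}\bigr)^2}\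 \ \bigl(s>\tfrac{\sqrt3}2r\bigr),\qquad F=\sqrt{\tfrac{r^2}4+s^2\bigl(\tfrac{4r^2}{3r^2-4s^2}\bigr)^2}\ \ \bigl(s<\tfrac{\sqrt3}2r\bigr).$$ If $s>\frac{\sqrt3}2r$ and $d_1>P$, there is exactly one number $d_3^*\in\bigl(h-s,\sqrt{h^2-s^2}\bigr)$ such that $O(S_{23-})=O(S_{12+})$ for the measurements $(d_1,d_1,d_3^*)$, namely $$d_3^*=\sqrt{(h-s)^2+\frac{2sr^2(h+s)}{s^2+r^2/4}} .$$ Below, "$X=\{\dots\}$" means that the listed points exist, are pairwise distinct, and that $X$ is the set of these points. Then: 1. $X=\{S_{12+},S_{23\pm},S_{31\pm}\}$ iff $s>\frac{\sqrt3}2r$, $d_1=P$, $d_3=\frac{4sr}{4s^2-3r^2}\sqrt{4s^2+r^2}$. 2. $X=\{S_{23\pm},S_{31\pm}\}$ iff $s>\frac{\sqrt3}2r$, $d_1>P$, $d_3=\sqrt{d_1^2-\frac{r^2}4-s^2}$. 3. $X=\{S_{12\pm},S_{23+},S_{31+}\}$ iff $s<\frac{\sqrt3}2r$, $d_1=F$,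 $d_3=\frac{s\sqrt{25r^4-24r^2s^2+16s^4}}{3r^2-4s^2}$. 4. $X=\{S_{12-},S_{23+},S_{31+}\}$ iff either $s<\frac{\sqrt3}2r$, $\sqrt{\frac{r^2}4+s^2}<d_1<F$, $d_3=M$; or $s\ge\frac{\sqrt3}2r$, $d_1>\sqrt{\frac{r^2}4+s^2}$, $d_3=M$. 5. $X=\{S_{12+},S_{23-},S_{31-}\}$ iff $s>\frac{\sqrt3}2r$, $d_1>P$, $d_3=d_3^*$. 6. $X=\{S_{12+},S_{23+},S_{31+}\}$ iff one of the following holds: $\sqrt{\frac{r^2}4+\frac{s^2}9}<d_1<\sqrt{\frac{r^2}4+s^2}$, $d_3=R$; or $s=\frac{\sqrt3}2r$, $d_1\ge r$, $d_3=d_1$; or $s<\frac{\sqrt3}2r$, $\sqrt{\frac{r^2}4+s^2}\le d_1<F$, $d_3=R$; or $s>\frac{\sqrt3}2r$, $\sqrt{\frac{r^2}4+s^2}\le d_1<P$, $d_3=R$. 7. $X=\{S_{12\pm}\}$ iff $s<\frac{\sqrt3}2r$, $d_1>F$, $d_3=\sqrt{d_1^2-\frac{r^2}4+s^2}$. 8.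 $X=\{S_{23-},S_{31-}\}$ iff $s>\frac{\sqrt3}2r$, $d_1>P$, $d_3^*<d_3<\sqrt{d_1^2-\frac{r^2}4-s^2}$. 9. $X=\{S_{23+},S_{31+}\}$ iff one of the following holds: $\frac r2<d_1<\sqrt{\frac{r^2}4+\frac{s^2}9}$, $s-h<d_3<s+h$; or $\sqrt{\frac{r^2}4+\frac{s^2}9}\le d_1\le\sqrt{\frac{r^2}4+s^2}$, $R<d_3<s+h$; or $s=\frac{\sqrt3}2r$, $d_1>r$, $R<d_3<\sqrt{d_1^2+2r^2}$; or $s<\frac{\sqrt3}2r$, $\sqrt{\frac{r^2}4+s^2}<d_1<F$, $R<d_3<M$; or $s>\frac{\sqrt3}2r$, $d_1>\sqrt{\frac{r^2}4+s^2}$, $\max\bigl(R,\sqrt{d_1^2-\frac{r^2}4-s^2}\bigr)<d_3<M$. Moreover, if $X$ has more than one point, then $X$ is one of the nine sets above. -/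

import Mathlib

open scoped Real

noncomputable section

namespace GPS

/-- The Euclidean plane. -/
abbrev Plane : Type := EuclideanSpace ℝ (Fin 2)

/-- The objective function `O(W) = ∑ j, | ‖W - Z j‖² - (d j)² |`.
Indices `0, 1, 2` stand for the sensors `1, 2, 3`. -/
def objective (Z : Fin 3 → Plane) (d : Fin 3 → ℝ) (W : Plane) : ℝ :=
  ∑ j, |dist W (Z j) ^ 2 - d j ^ 2|

/-- The set `X` of global minimizers of the objective function over the plane. -/
def minimizers (Z : Fin 3 → Plane) (d : Fin 3 → ℝ) : Set Plane :=
  {W | IsMinOn (objective Z d) Set.univ W}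

/-- The intersection `S_ij` of the `i`-th and the `j`-th measurement circles. -/
def circleInter (Z : Fin 3 → Plane) (d : Fin 3 → ℝ) (i j : Fin 3) : Set Plane :=
  Metric.sphere (Z i) (d i) ∩ Metric.sphere (Z j) (d j)

/-- The points of `S_ij` nearest to the sensor `Z k`: for `k` the third index this is the
singleton of `S_ij+`, or the empty set when the two circles do not meet. -/
def nearPt (Z : Fin 3 → Plane) (d : Fin 3 → ℝ) (i j k : Fin 3) : Set Plane :=
  {p | p ∈ circleInter Z d i j ∧ ∀ q ∈ circleInter Z d i j, dist p (Z k) ≤ dist q (Z k)}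

/-- The points of `S_ij` farthest from the sensor `Z k`: for `k` the third index this is the
singleton of `S_ij-`, or the empty set when the two circles do not meet. -/
def farPt (Z : Fin 3 → Plane) (d : Fin 3 → ℝ) (i j k : Fin 3) : Set Plane :=
  {p | p ∈ circleInter Z d i j ∧ ∀ q ∈ circleInter Z d i j, dist q (Z k) ≤ dist p (Z k)}

/-- `S_12+` -/
def S12p (Z : Fin 3 → Plane) (d : Fin 3 → ℝ) : Set Plane := nearPt Z d 0 1 2
/-- `S_12-` -/
def S12m (Z : Fin 3 → Plane) (d : Fin 3 → ℝ) : Set Plane := farPt Z d 0 1 2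
/-- `S_23+` -/
def S23p (Z : Fin 3 → Plane) (d : Fin 3 → ℝ) : Set Plane := nearPt Z d 1 2 0
/-- `S_23-` -/
def S23m (Z : Fin 3 → Plane) (d : Fin 3 → ℝ) : Set Plane := farPt Z d 1 2 0
/-- `S_31+` -/
def S31p (Z : Fin 3 → Plane) (d : Fin 3 → ℝ) : Set Plane := nearPt Z d 2 0 1
/-- `S_31-` -/
def S31m (Z : Fin 3 → Plane) (d : Fin 3 → ℝ) : Set Plane := farPt Z d 2 0 1

/-- `X` consists of exactly `n` pairwise distinct points, the `i`-th of which lies in `A i`.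
Applied to the sets above it says `X = {S_.., ..., S_..}`, the listed points existing and
being pairwise distinct. -/
def ConsistsOf {n : ℕ} (X : Set Plane) (A : Fin n → Set Plane) : Prop :=
  ∃ p : Fin n → Plane, Function.Injective p ∧ (∀ i, p i ∈ A i) ∧ X = Set.range p

/-- The threshold for `d₁` in the sharp case `s > (√3 / 2) r`. -/
def sharpBound (r s : ℝ) : ℝ :=
  √(r ^ 2 / 4 + s ^ 2 * ((4 * s ^ 2 + 5 * r ^ 2) / (4 * s ^ 2 - 3 * r ^ 2)) ^ 2)

/-- The threshold for `d₁` in the flat case `s < (√3 / 2) r`. -/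
def flatBound (r s : ℝ) : ℝ :=
  √(r ^ 2 / 4 + s ^ 2 * (4 * r ^ 2 / (3 * r ^ 2 - 4 * s ^ 2)) ^ 2)

/-- The constant `R`. -/
def constR (r s d₁ : ℝ) : ℝ :=
  √(d₁ ^ 2 - r ^ 2 / 4 + s ^ 2 * ((4 * s ^ 2 + r ^ 2) / (4 * s ^ 2 + 9 * r ^ 2))
    - 2 * s * √(d₁ ^ 2 - r ^ 2 / 4) * ((4 * s ^ 2 - 3 * r ^ 2) / (4 * s ^ 2 + 9 * r ^ 2)))

/-- The constant `M`. -/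
def constM (r s d₁ : ℝ) : ℝ :=
  √(d₁ ^ 2 - r ^ 2 / 4
    + 2 * s * √(d₁ ^ 2 - r ^ 2 / 4) * ((4 * s ^ 2 - 3 * r ^ 2) / (4 * s ^ 2 + r ^ 2))
    + s ^ 2 * ((4 * s ^ 2 + 9 * r ^ 2) / (4 * s ^ 2 + r ^ 2)))

/-- The constant `d₃*` in closed form. Its defining property (in the sharp case, above the
threshold, it is the only measurement `d₃` in an explicit interval for which `S_23-` and `S_12+`
have the same objective value) is `DStarSpec`. -/
def dStar (r s d₁ : ℝ) : ℝ :=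
  √((√(d₁ ^ 2 - r ^ 2 / 4) - s) ^ 2
    + 2 * s * r ^ 2 * (√(d₁ ^ 2 - r ^ 2 / 4) + s) / (s ^ 2 + r ^ 2 / 4))

/-- `x₀` is the unique point of the open interval
`(√(d₁² - r²/4) - s, √(d₁² - r²/4 - s²))` such that for the measurements `(d₁, d₁, x₀)` one
has `O(S_23-) = O(S_12+)`. -/
def DStarSpec (Z : Fin 3 → Plane) (r s d₁ x₀ : ℝ) : Prop :=
  x₀ ∈ Set.Ioo (√(d₁ ^ 2 - r ^ 2 / 4) - s) (√(d₁ ^ 2 - r ^ 2 / 4 - s ^ 2)) ∧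
  ∀ x ∈ Set.Ioo (√(d₁ ^ 2 - r ^ 2 / 4) - s) (√(d₁ ^ 2 - r ^ 2 / 4 - s ^ 2)),
    ((∃ p ∈ S23m Z ![d₁, d₁, x], ∃ q ∈ S12p Z ![d₁, d₁, x],
      objective Z ![d₁, d₁, x] p = objective Z ![d₁, d₁, x] q) ↔ x = x₀)

end GPS

end

/-!
# Global minimizers of the GPS objective for an isosceles triangle of sensors
-/

namespace GPS

/-! Place the sensors at (∓r/2, 0) and (0, s), and put H = d₁² − r²/4 and d₃² = H + s² − 2sy₀. The
three residuals then share the quadratic part x² + y² − H, so they are independent affine functions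
of (x, y, u) restricted to the paraboloid u = x² + y². In the residuals as coordinates the objective
is the ℓ¹ norm, whose balls are octahedra around the common zero (0, y₀, H).

If this centre is not strictly inside the paraboloid (H ≤ y₀²), pulling the lifted midpoint of two
minimizers towards it meets the paraboloid at a smaller value, so there is at most one minimizer
(`minimizer_unique`). If it is inside, let the octahedron grow until some vertex reaches the
paraboloid. By strict convexity the two touch only at vertices (`vertex_of_l1_le`). At a vertex two
residuals vanish, so it lies on two measurement circles: the minimizers are the best among the six
points S_ij± (`exists_vertexConfig`).

With h = √H the values at these points are 2s(h − y₀) and 2s(h + y₀) on the axis of symmetry, and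
−2rm and 2rp at the two mirror pairs, where m < 0 < p are the roots of an explicit quadratic. Every
comparison needed has the sign of an expression affine in y₀ (`value_signs`). The order of the four
values therefore determines the set of minimizers, and the constants R, M, P, F and d₃* are the
places where these affine expressions vanish. What remains is to translate the sign conditions on
(h, y₀) into the stated regions of (d₁, d₃). -/

/-! ### Convexity of the paraboloid and ℓ¹ balls -/

/-- Strict convexity of the paraboloid: a point of the paraboloid whose `ℓ¹` distance from an
interior point is at most `c` is a vertex of the inscribed octahedron of radius `c`. -/
theorem vertex_of_l1_le {r s y₀ H c x y : ℝ} (hr : 0 < r) (hs : 0 < s) (hc : 0 < c)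
    (hin : y₀ ^ 2 < H)
    (hA : ∀ σ : ℝ, σ = 1 ∨ σ = -1 → (y₀ - σ * c / (2 * s)) ^ 2 ≤ H)
    (hB : ∀ σ : ℝ, σ = 1 ∨ σ = -1 →
      (σ * c / (2 * r)) ^ 2 + (y₀ + σ * c / (4 * s)) ^ 2 ≤ H + σ * c / 2)
    (hle : |x ^ 2 + y ^ 2 - H + r * x| + |x ^ 2 + y ^ 2 - H - r * x|
      + |x ^ 2 + y ^ 2 - H - 2 * s * (y - y₀)| ≤ c) :
    (x ^ 2 + y ^ 2 - H - r * x = 0 ∧ x ^ 2 + y ^ 2 - H - 2 * s * (y - y₀) = 0) ∨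
    (x ^ 2 + y ^ 2 - H + r * x = 0 ∧ x ^ 2 + y ^ 2 - H - 2 * s * (y - y₀) = 0) ∨
    (x ^ 2 + y ^ 2 - H + r * x = 0 ∧ x ^ 2 + y ^ 2 - H - r * x = 0) := by
  obtain ⟨q0, hq0⟩ : ∃ q, q = x ^ 2 + y ^ 2 - H + r * x := ⟨_, rfl⟩
  obtain ⟨q1, hq1⟩ : ∃ q, q = x ^ 2 + y ^ 2 - H - r * x := ⟨_, rfl⟩
  obtain ⟨q2, hq2⟩ : ∃ q, q = x ^ 2 + y ^ 2 - H - 2 * s * (y - y₀) := ⟨_, rfl⟩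
  rw [← hq0, ← hq1, ← hq2] at hle ⊢
  have sgn : ∀ q : ℝ, ∃ σ l : ℝ, (σ = 1 ∨ σ = -1) ∧ 0 ≤ l ∧ q = l * (σ * c) ∧ |q| = l * c := by
    intro q
    rcases le_total 0 q with h | h
    · refine ⟨1, q / c, Or.inl rfl, by positivity, by field_simp, ?_⟩
      rw [abs_of_nonneg h]; field_simp
    · refine ⟨-1, -q / c, Or.inr rfl, div_nonneg (by linarith) hc.le, by field_simp, ?_⟩
      rw [abs_of_nonpos h]; field_simp
  obtain ⟨σ0, l0, hσ0, hl0, e0, a0⟩ := sgn q0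
  obtain ⟨σ1, l1, hσ1, hl1, e1, a1⟩ := sgn q1
  obtain ⟨σ2, l2, hσ2, hl2, e2, a2⟩ := sgn q2
  have hx : x = (q0 - q1) / (2 * r) := by rw [hq0, hq1]; field_simp; ring
  have hy : y = y₀ + (q0 + q1 - 2 * q2) / (4 * s) := by rw [hq0, hq1, hq2]; field_simp; ring
  have hu : x ^ 2 + y ^ 2 = H + (q0 + q1) / 2 := by rw [hq0, hq1]; ring
  obtain ⟨m, hm⟩ : ∃ m, m = 1 - l0 - l1 - l2 := ⟨_, rfl⟩
  have hm0 : 0 ≤ m := by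
    rw [a0, a1, a2] at hle
    have : (l0 + l1 + l2) * c ≤ 1 * c := by linarith
    have := le_of_mul_le_mul_right this hc
    linarith
  obtain ⟨a, ha⟩ : ∃ a, a = c / (2 * r) := ⟨_, rfl⟩
  obtain ⟨b, hb⟩ : ∃ b, b = c / (4 * s) := ⟨_, rfl⟩
  have ha0 : 0 < a := by rw [ha]; positivity
  have hb0 : 0 < b := by rw [hb]; positivity
  have hx' : x = a * (l0 * σ0 - l1 * σ1) := by rw [hx, e0, e1, ha]; field_simp
  have hy' : y = y₀ + b * (l0 * σ0 + l1 * σ1 - 2 * (l2 * σ2)) := by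
    rw [hy, e0, e1, e2, hb]; field_simp
  have hu' : x ^ 2 + y ^ 2 = H + c * (l0 * σ0 + l1 * σ1) / 2 := by rw [hu, e0, e1]; ring
  have n2 : (y₀ - 2 * (σ2 * b)) ^ 2 - H ≤ 0 := by
    have := hA σ2 hσ2
    rw [show σ2 * c / (2 * s) = 2 * (σ2 * b) by rw [hb]; field_simp; ring] at this
    linarith
  -- The vertices on the first two residual axes are mirror images under x ↦ −x, so one condition
  -- serves both.
  have nB : ∀ σ : ℝ, σ = 1 ∨ σ = -1 →
      (σ * a) ^ 2 + (y₀ + σ * b) ^ 2 - H - σ * c / 2 ≤ 0 := by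
    intro σ hσ
    have := hB σ hσ
    rw [show σ * c / (2 * r) = σ * a by rw [ha]; field_simp,
      show σ * c / (4 * s) = σ * b by rw [hb]; field_simp] at this
    linarith
  have n0 := nB σ0 hσ0
  have n1 := nB σ1 hσ1
  -- The point is the convex combination of three vertices, with weights l0, l1, l2, and of the
  -- centre, with weight m. For g = x² + y² − u, the value g(∑ wᵢvᵢ) equals ∑ wᵢ g(vᵢ) minus ∑_{i<j}
  -- wᵢwⱼ times the squared planar distance of vᵢ and vⱼ. The left side is 0 on the paraboloid and
  -- no term on the right is positive, so every term vanishes. The vertices have distinct planar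
  -- projections, so at most one lᵢ is nonzero.
  have key : 0 = l0 * ((σ0 * a) ^ 2 + (y₀ + σ0 * b) ^ 2 - H - σ0 * c / 2)
      + l1 * ((σ1 * a) ^ 2 + (y₀ + σ1 * b) ^ 2 - H - σ1 * c / 2)
      + l2 * ((y₀ - 2 * (σ2 * b)) ^ 2 - H) + m * (y₀ ^ 2 - H)
      - l0 * l1 * (((σ0 + σ1) * a) ^ 2 + ((σ0 - σ1) * b) ^ 2)
      - l0 * l2 * ((σ0 * a) ^ 2 + ((σ0 + 2 * σ2) * b) ^ 2)
      - l1 * l2 * ((σ1 * a) ^ 2 + ((σ1 + 2 * σ2) * b) ^ 2)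
      - m * l0 * ((σ0 * a) ^ 2 + (σ0 * b) ^ 2) - m * l1 * ((σ1 * a) ^ 2 + (σ1 * b) ^ 2)
      - m * l2 * (2 * (σ2 * b)) ^ 2 := by
    rw [hx', hy'] at hu'
    rw [hm]
    linear_combination (-1 : ℝ) * hu'
  have p01 : 0 < ((σ0 + σ1) * a) ^ 2 + ((σ0 - σ1) * b) ^ 2 := by
    rcases hσ0 with rfl | rfl <;> rcases hσ1 with rfl | rfl <;> norm_num <;> positivity
  have p02 : 0 < (σ0 * a) ^ 2 + ((σ0 + 2 * σ2) * b) ^ 2 := by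
    rcases hσ0 with rfl | rfl <;> positivity
  have p12 : 0 < (σ1 * a) ^ 2 + ((σ1 + 2 * σ2) * b) ^ 2 := by
    rcases hσ1 with rfl | rfl <;> positivity
  have t0 := mul_nonpos_of_nonneg_of_nonpos hl0 n0
  have t1 := mul_nonpos_of_nonneg_of_nonpos hl1 n1
  have t2 := mul_nonpos_of_nonneg_of_nonpos hl2 n2
  have tm := mul_nonpos_of_nonneg_of_nonpos hm0 (sub_nonpos.2 hin.le)
  have s01 : 0 ≤ l0 * l1 * (((σ0 + σ1) * a) ^ 2 + ((σ0 - σ1) * b) ^ 2) := by positivity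
  have s02 : 0 ≤ l0 * l2 * ((σ0 * a) ^ 2 + ((σ0 + 2 * σ2) * b) ^ 2) := by positivity
  have s12 : 0 ≤ l1 * l2 * ((σ1 * a) ^ 2 + ((σ1 + 2 * σ2) * b) ^ 2) := by positivity
  have sm0 : 0 ≤ m * l0 * ((σ0 * a) ^ 2 + (σ0 * b) ^ 2) := by positivity
  have sm1 : 0 ≤ m * l1 * ((σ1 * a) ^ 2 + (σ1 * b) ^ 2) := by positivity
  have sm2 : 0 ≤ m * l2 * (2 * (σ2 * b)) ^ 2 := by positivity
  have z01 : l0 * l1 = 0 := by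
    refine (mul_eq_zero.1 (le_antisymm ?_ s01)).resolve_right p01.ne'
    linarith
  have z02 : l0 * l2 = 0 := by
    refine (mul_eq_zero.1 (le_antisymm ?_ s02)).resolve_right p02.ne'
    linarith
  have z12 : l1 * l2 = 0 := by
    refine (mul_eq_zero.1 (le_antisymm ?_ s12)).resolve_right p12.ne'
    linarith
  rw [e0, e1, e2]
  rcases mul_eq_zero.1 z01 with h | h
  · rcases mul_eq_zero.1 z12 with h' | h'
    · exact Or.inr (Or.inr ⟨by rw [h, zero_mul], by rw [h', zero_mul]⟩)
    · exact Or.inr (Or.inl ⟨by rw [h, zero_mul], by rw [h', zero_mul]⟩)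
  · rcases mul_eq_zero.1 z02 with h' | h'
    · exact Or.inr (Or.inr ⟨by rw [h', zero_mul], by rw [h, zero_mul]⟩)
    · exact Or.inl ⟨by rw [h, zero_mul], by rw [h', zero_mul]⟩

/-- If the common zero of the lifted residuals is not strictly inside the paraboloid, then there
is at most one minimizer. -/
theorem minimizer_unique {r s y₀ H x y x' y' : ℝ} (hr : 0 < r) (hs : 0 < s)
    (hout : H ≤ y₀ ^ 2) {f : ℝ → ℝ → ℝ}
    (hf : ∀ x y, f x y = |x ^ 2 + y ^ 2 - H + r * x| + |x ^ 2 + y ^ 2 - H - r * x|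
      + |x ^ 2 + y ^ 2 - H - 2 * s * (y - y₀)|)
    (hm : ∀ a b, f x y ≤ f a b) (hm' : ∀ a b, f x' y' ≤ f a b) : x = x' ∧ y = y' := by
  by_contra hne
  have hfeq : f x y = f x' y' := le_antisymm (hm _ _) (hm' _ _)
  obtain ⟨a, ha⟩ : ∃ a, a = (x + x') / 2 := ⟨_, rfl⟩
  obtain ⟨b, hb⟩ : ∃ b, b = (y + y') / 2 := ⟨_, rfl⟩
  obtain ⟨u, hu⟩ : ∃ u, u = (x ^ 2 + y ^ 2 + (x' ^ 2 + y' ^ 2)) / 2 := ⟨_, rfl⟩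
  have hlt : a ^ 2 + b ^ 2 < u := by
    have : 0 < (x - x') ^ 2 + (y - y') ^ 2 := by
      by_contra h
      have h1 : (x - x') ^ 2 = 0 := by nlinarith [sq_nonneg (x - x'), sq_nonneg (y - y')]
      have h2 : (y - y') ^ 2 = 0 := by nlinarith [sq_nonneg (x - x'), sq_nonneg (y - y')]
      exact hne ⟨by simpa [sub_eq_zero] using h1, by simpa [sub_eq_zero] using h2⟩
    rw [ha, hb, hu]; nlinarith
  have mid : ∀ p q : ℝ, |(p + q) / 2| ≤ (|p| + |q|) / 2 := fun p q => by
    rw [abs_div, abs_two]; linarith [abs_add_le p q]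
  have hmid : |u - H + r * a| + |u - H - r * a| + |u - H - 2 * s * (b - y₀)| ≤ f x y := by
    have e := hf x y
    have e' := hf x' y'
    have i0 := mid (x ^ 2 + y ^ 2 - H + r * x) (x' ^ 2 + y' ^ 2 - H + r * x')
    have i1 := mid (x ^ 2 + y ^ 2 - H - r * x) (x' ^ 2 + y' ^ 2 - H - r * x')
    have i2 := mid (x ^ 2 + y ^ 2 - H - 2 * s * (y - y₀)) (x' ^ 2 + y' ^ 2 - H - 2 * s * (y' - y₀))
    rw [show u - H + r * a = (x ^ 2 + y ^ 2 - H + r * x + (x' ^ 2 + y' ^ 2 - H + r * x')) / 2 by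
        rw [hu, ha]; ring,
      show u - H - r * a = (x ^ 2 + y ^ 2 - H - r * x + (x' ^ 2 + y' ^ 2 - H - r * x')) / 2 by
        rw [hu, ha]; ring,
      show u - H - 2 * s * (b - y₀) = (x ^ 2 + y ^ 2 - H - 2 * s * (y - y₀)
        + (x' ^ 2 + y' ^ 2 - H - 2 * s * (y' - y₀))) / 2 by rw [hu, hb]; ring]
    linarith
  -- The function is u − x² − y² along the segment from the common zero (t = 0, not inside) to the
  -- lifted midpoint (t = 1, strictly inside). On this segment the residuals scale by t.
  obtain ⟨t, ⟨ht0, ht1⟩, ht⟩ : (0 : ℝ) ∈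
      (fun t : ℝ => H + t * (u - H) - (t * a) ^ 2 - (y₀ + t * (b - y₀)) ^ 2) '' Set.Icc 0 1 :=
    intermediate_value_Icc zero_le_one (by fun_prop) ⟨by norm_num; linarith, by norm_num; linarith⟩
  dsimp only at ht
  have htlt : t < 1 := by
    refine lt_of_le_of_ne ht1 ?_
    rintro rfl
    norm_num at ht
    linarith
  have hval : f (t * a) (y₀ + t * (b - y₀)) ≤ t * f x y := by
    have hU : (t * a) ^ 2 + (y₀ + t * (b - y₀)) ^ 2 = H + t * (u - H) := by linarith
    rw [hf (t * a), hU, show H + t * (u - H) - H + r * (t * a) = t * (u - H + r * a) by ring,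
      show H + t * (u - H) - H - r * (t * a) = t * (u - H - r * a) by ring,
      show H + t * (u - H) - H - 2 * s * (y₀ + t * (b - y₀) - y₀)
        = t * (u - H - 2 * s * (b - y₀)) by ring, abs_mul, abs_mul, abs_mul, abs_of_nonneg ht0]
    nlinarith
  -- Minimality gives f ≤ t f with t < 1.
  have hzero : f x y = 0 := by
    have h0 : 0 ≤ f x y := by rw [hf]; positivity
    have := (hm _ _).trans hval
    nlinarith
  have vanish : ∀ x y, f x y = 0 → x = 0 ∧ y = y₀ := by
    intro x y h
    rw [hf] at h
    have p0 := abs_nonneg (x ^ 2 + y ^ 2 - H + r * x)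
    have p1 := abs_nonneg (x ^ 2 + y ^ 2 - H - r * x)
    have p2 := abs_nonneg (x ^ 2 + y ^ 2 - H - 2 * s * (y - y₀))
    have e0 := abs_eq_zero.1 (le_antisymm (by linarith) p0)
    have e1 := abs_eq_zero.1 (le_antisymm (by linarith) p1)
    have e2 := abs_eq_zero.1 (le_antisymm (by linarith) p2)
    have hx : r * x = 0 := by linarith
    have hy : s * (y - y₀) = 0 := by linarith
    exact ⟨(mul_eq_zero.1 hx).resolve_left hr.ne',
      sub_eq_zero.1 ((mul_eq_zero.1 hy).resolve_left hs.ne')⟩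
  have v := vanish x y hzero
  have v' := vanish x' y' (hfeq ▸ hzero)
  exact hne ⟨v.1.trans v'.1.symm, v.2.trans v'.2.symm⟩

theorem exists_roots {α β γ : ℝ} (hα : 0 < α) (hγ : 0 < γ) :
    ∃ m p : ℝ, m < 0 ∧ 0 < p ∧ α * (m + p) = β ∧ α * (m * p) = -γ := by
  have hD : β ^ 2 < β ^ 2 + 4 * α * γ := by nlinarith [mul_pos hα hγ]
  have hq : √(β ^ 2 + 4 * α * γ) ^ 2 = β ^ 2 + 4 * α * γ :=
    Real.sq_sqrt (by nlinarith [sq_nonneg β])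
  have hlt : |β| < √(β ^ 2 + 4 * α * γ) := by
    rw [← Real.sqrt_sq_eq_abs]; exact Real.sqrt_lt_sqrt (sq_nonneg β) hD
  obtain ⟨h1, h2⟩ := abs_lt.1 hlt
  refine ⟨(β - √(β ^ 2 + 4 * α * γ)) / (2 * α), (β + √(β ^ 2 + 4 * α * γ)) / (2 * α),
    div_neg_of_neg_of_pos (by linarith) (by linarith), div_pos (by linarith) (by linarith),
    by field_simp; ring, ?_⟩
  generalize √(β ^ 2 + 4 * α * γ) = w at hq
  field_simp
  linear_combination (-1 : ℝ) * hq

/-! ### Coordinates adapted to the triangle -/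

/-- Cartesian coordinates adapted to an isosceles triangle. -/
theorem exists_coordinates {Z : Fin 3 → Plane} (hZ : AffineIndependent ℝ Z)
    (hiso : dist (Z 0) (Z 2) = dist (Z 1) (Z 2)) {r s : ℝ} (hr : r = dist (Z 0) (Z 1))
    (hs : s = dist (Z 2) (midpoint ℝ (Z 0) (Z 1))) :
    0 < r ∧ 0 < s ∧ ∃ φ : Plane ≃ ℝ × ℝ, ∀ W,
      dist W (Z 0) ^ 2 = ((φ W).1 + r / 2) ^ 2 + (φ W).2 ^ 2 ∧
      dist W (Z 1) ^ 2 = ((φ W).1 - r / 2) ^ 2 + (φ W).2 ^ 2 ∧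
      dist W (Z 2) ^ 2 = (φ W).1 ^ 2 + ((φ W).2 - s) ^ 2 := by
  have h01 : Z 0 ≠ Z 1 := hZ.injective.ne (by decide)
  have hr0 : 0 < r := hr ▸ dist_pos.2 h01
  have hs0 : 0 < s := by
    rw [hs, dist_pos]
    intro h
    have hcol : Collinear ℝ {Z 0, Z 1, Z 2} := by
      rw [collinear_iff_of_mem (p₀ := Z 0) (by simp)]
      refine ⟨Z 1 - Z 0, ?_⟩
      simp only [Set.mem_insert_iff, Set.mem_singleton_iff]
      rintro p (rfl | rfl | rfl)
      · exact ⟨0, by simp⟩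
      · exact ⟨1, by simp⟩
      · refine ⟨1 / 2, ?_⟩
        rw [h, midpoint_eq_smul_add]
        simp only [vadd_eq_add, invOf_eq_inv]
        module
    refine (affineIndependent_iff_not_collinear_set.1 ?_) hcol
    have h3 : ![Z 0, Z 1, Z 2] = Z := by funext i; fin_cases i <;> rfl
    rwa [h3]
  refine ⟨hr0, hs0, ?_⟩
  obtain ⟨m, hm⟩ : ∃ m, m = midpoint ℝ (Z 0) (Z 1) := ⟨_, rfl⟩
  obtain ⟨u, hu⟩ : ∃ u, u = r⁻¹ • (Z 1 - Z 0) := ⟨_, rfl⟩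
  obtain ⟨v, hv⟩ : ∃ v, v = s⁻¹ • (Z 2 - m) := ⟨_, rfl⟩
  have z0 : Z 0 = m - (r / 2) • u := by
    rw [hu, hm, midpoint_eq_smul_add, smul_smul, show r / 2 * r⁻¹ = 1 / 2 by field_simp]
    simp only [invOf_eq_inv]; module
  have z1 : Z 1 = m + (r / 2) • u := by
    rw [hu, hm, midpoint_eq_smul_add, smul_smul, show r / 2 * r⁻¹ = 1 / 2 by field_simp]
    simp only [invOf_eq_inv]; module
  have z2 : Z 2 = m + s • v := by
    rw [hv, smul_smul, mul_inv_cancel₀ hs0.ne', one_smul]; abel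
  have nu : ‖u‖ = 1 := by
    rw [hu, norm_smul, norm_inv, Real.norm_of_nonneg hr0.le, ← dist_eq_norm, dist_comm, ← hr,
      inv_mul_cancel₀ hr0.ne']
  have nv : ‖v‖ = 1 := by
    rw [hv, norm_smul, norm_inv, Real.norm_of_nonneg hs0.le, ← dist_eq_norm, hm, ← hs,
      inv_mul_cancel₀ hs0.ne']
  -- The equal legs say ‖a + b‖ = ‖a − b‖ for a along the base and b along the median, so the median
  -- is an altitude.
  have huv : inner ℝ u v = 0 := by
    have h : ‖(r / 2) • u + s • v‖ ^ 2 = ‖(r / 2) • u - s • v‖ ^ 2 := by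
      rw [dist_eq_norm, dist_eq_norm, z0, z1, z2] at hiso
      rw [show (m - (r / 2) • u - (m + s • v)) = -((r / 2) • u + s • v) by abel, norm_neg,
        show (m + (r / 2) • u - (m + s • v)) = (r / 2) • u - s • v by abel] at hiso
      rw [hiso]
    rw [norm_add_sq_real, norm_sub_sq_real, inner_smul_left, inner_smul_right] at h
    simp only [conj_trivial] at h
    have : r * s * inner ℝ u v = 0 := by linarith
    exact (mul_eq_zero.1 this).resolve_left (by positivity)
  have ho : Orthonormal ℝ ![u, v] := by
    rw [orthonormal_iff_ite]
    intro i j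
    fin_cases i <;> fin_cases j <;>
      simp [nu, nv, huv, real_inner_comm]
  let b : OrthonormalBasis (Fin 2) ℝ Plane :=
    (basisOfOrthonormalOfCardEqFinrank ho (by simp)).toOrthonormalBasis
      (by rw [coe_basisOfOrthonormalOfCardEqFinrank]; exact ho)
  have b0 : b 0 = u := by simp [b]
  have b1 : b 1 = v := by simp [b]
  let φ : Plane ≃ ℝ × ℝ := (Equiv.subRight m).trans
    (b.repr.toEquiv.trans ((WithLp.equiv 2 (Fin 2 → ℝ)).trans (finTwoArrowEquiv ℝ)))
  have hφ : ∀ W, φ W = (inner ℝ u (W - m), inner ℝ v (W - m)) := by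
    intro W
    simp [φ, ← b0, ← b1, OrthonormalBasis.repr_apply_apply, inner_sub_right]
  have hn : ∀ w : Plane, ‖w‖ ^ 2 = inner ℝ u w ^ 2 + inner ℝ v w ^ 2 := by
    intro w
    rw [← b.sum_sq_inner_left w, Fin.sum_univ_two, b0, b1, real_inner_comm, real_inner_comm w v]
  refine ⟨φ, fun W => ?_⟩
  have hvu : inner ℝ v u = 0 := by rw [real_inner_comm]; exact huv
  rw [hφ, dist_eq_norm, dist_eq_norm, dist_eq_norm, z0, z1, z2,
    show W - (m - (r / 2) • u) = (W - m) + (r / 2) • u by abel,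
    show W - (m + (r / 2) • u) = (W - m) - (r / 2) • u by abel,
    show W - (m + s • v) = (W - m) - s • v by abel, hn, hn, hn]
  simp only [inner_add_right, inner_sub_right, inner_smul_right, huv, hvu,
    real_inner_self_eq_norm_sq, nu, nv]
  refine ⟨?_, ?_, ?_⟩ <;> ring

/-! ### The six intersection points and the minimizers -/

theorem nearPt_eq_singleton {Z : Fin 3 → Plane} {d : Fin 3 → ℝ} {i j k : Fin 3} {p q : Plane}
    (h : circleInter Z d i j = {p, q}) (hlt : dist p (Z k) < dist q (Z k)) :
    nearPt Z d i j k = {p} := by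
  ext w
  simp only [nearPt, h, Set.mem_ofPred_eq, Set.mem_insert_iff, Set.mem_singleton_iff,
    forall_eq_or_imp, forall_eq]
  constructor
  · rintro ⟨rfl | rfl, h1, h2⟩
    · rfl
    · exact absurd hlt h1.not_gt
  · rintro rfl
    exact ⟨Or.inl rfl, le_rfl, hlt.le⟩

theorem farPt_eq_singleton {Z : Fin 3 → Plane} {d : Fin 3 → ℝ} {i j k : Fin 3} {p q : Plane}
    (h : circleInter Z d i j = {p, q}) (hlt : dist p (Z k) < dist q (Z k)) :
    farPt Z d i j k = {q} := by
  ext w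
  simp only [farPt, h, Set.mem_ofPred_eq, Set.mem_insert_iff, Set.mem_singleton_iff,
    forall_eq_or_imp, forall_eq]
  constructor
  · rintro ⟨rfl | rfl, h1, h2⟩
    · exact absurd hlt h2.not_gt
    · rfl
  · rintro rfl
    exact ⟨Or.inr rfl, hlt.le, le_rfl⟩

/-- The six points `S_ij±` exist and are pairwise distinct, the objective takes the values
`Ap, Am, Bp, Bm, Bp, Bm` there, and its minimizers are those of the six points at which the
value is least. -/
structure VertexConfig (Z : Fin 3 → Plane) (d : Fin 3 → ℝ) (e : Fin 6 → Plane)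
    (Ap Am Bp Bm : ℝ) : Prop where
  inj : Function.Injective e
  s12p : S12p Z d = {e 0}
  s12m : S12m Z d = {e 1}
  s23p : S23p Z d = {e 2}
  s23m : S23m Z d = {e 3}
  s31p : S31p Z d = {e 4}
  s31m : S31m Z d = {e 5}
  val : ∀ i, objective Z d (e i) = ![Ap, Am, Bp, Bm, Bp, Bm] i
  mem : ∀ W, W ∈ minimizers Z d ↔
    ∃ i, W = e i ∧ ∀ j, ![Ap, Am, Bp, Bm, Bp, Bm] i ≤ ![Ap, Am, Bp, Bm, Bp, Bm] j

section Coordinates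

variable {Z : Fin 3 → Plane} {d : Fin 3 → ℝ} {r s y₀ H : ℝ} {φ : Plane ≃ ℝ × ℝ}

theorem objective_eq
    (h0 : ∀ W, dist W (Z 0) ^ 2 - d 0 ^ 2 = (φ W).1 ^ 2 + (φ W).2 ^ 2 - H + r * (φ W).1)
    (h1 : ∀ W, dist W (Z 1) ^ 2 - d 1 ^ 2 = (φ W).1 ^ 2 + (φ W).2 ^ 2 - H - r * (φ W).1)
    (h2 : ∀ W, dist W (Z 2) ^ 2 - d 2 ^ 2
      = (φ W).1 ^ 2 + (φ W).2 ^ 2 - H - 2 * s * ((φ W).2 - y₀)) (W : Plane) :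
    objective Z d W = |(φ W).1 ^ 2 + (φ W).2 ^ 2 - H + r * (φ W).1|
      + |(φ W).1 ^ 2 + (φ W).2 ^ 2 - H - r * (φ W).1|
      + |(φ W).1 ^ 2 + (φ W).2 ^ 2 - H - 2 * s * ((φ W).2 - y₀)| := by
  rw [objective, Fin.sum_univ_three, h0, h1, h2]

theorem minimizers_subsingleton (hr : 0 < r) (hs : 0 < s)
    (h0 : ∀ W, dist W (Z 0) ^ 2 - d 0 ^ 2 = (φ W).1 ^ 2 + (φ W).2 ^ 2 - H + r * (φ W).1)
    (h1 : ∀ W, dist W (Z 1) ^ 2 - d 1 ^ 2 = (φ W).1 ^ 2 + (φ W).2 ^ 2 - H - r * (φ W).1)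
    (h2 : ∀ W, dist W (Z 2) ^ 2 - d 2 ^ 2
      = (φ W).1 ^ 2 + (φ W).2 ^ 2 - H - 2 * s * ((φ W).2 - y₀))
    (hout : H ≤ y₀ ^ 2) : (minimizers Z d).Subsingleton := by
  intro p hp q hq
  have hf : ∀ a b, objective Z d (φ.symm (a, b)) = |a ^ 2 + b ^ 2 - H + r * a|
      + |a ^ 2 + b ^ 2 - H - r * a| + |a ^ 2 + b ^ 2 - H - 2 * s * (b - y₀)| := by
    intro a b
    rw [objective_eq h0 h1 h2, φ.apply_symm_apply]
  have min_of : ∀ p ∈ minimizers Z d, ∀ a b : ℝ,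
      objective Z d (φ.symm ((φ p).1, (φ p).2)) ≤ objective Z d (φ.symm (a, b)) := by
    intro p hp a b
    rw [Prod.mk.eta, φ.symm_apply_apply]
    exact hp (Set.mem_univ _)
  obtain ⟨h, h'⟩ := minimizer_unique (f := fun a b => objective Z d (φ.symm (a, b))) hr hs hout hf
    (min_of p hp) (min_of q hq)
  exact φ.injective (Prod.ext h h')

-- The common zero (0, y₀) of the lifted residuals is inside the paraboloid, so each line on which
-- two residuals vanish meets the paraboloid on both sides of it. This gives the six points, and m,
-- p are the abscissae on the radical axis of the second and third circles. The least of the six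
-- values is the radius of the largest inscribed octahedron, so no point of the plane does better.
set_option maxHeartbeats 1600000 in
theorem exists_vertexConfig (hr : 0 < r) (hs : 0 < s) (hd : ∀ i, 0 < d i)
    (h0 : ∀ W, dist W (Z 0) ^ 2 - d 0 ^ 2 = (φ W).1 ^ 2 + (φ W).2 ^ 2 - H + r * (φ W).1)
    (h1 : ∀ W, dist W (Z 1) ^ 2 - d 1 ^ 2 = (φ W).1 ^ 2 + (φ W).2 ^ 2 - H - r * (φ W).1)
    (h2 : ∀ W, dist W (Z 2) ^ 2 - d 2 ^ 2
      = (φ W).1 ^ 2 + (φ W).2 ^ 2 - H - 2 * s * ((φ W).2 - y₀))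
    {h : ℝ} (hh : 0 < h) (hhH : h ^ 2 = H) (hin : y₀ ^ 2 < H) :
    ∃ e m p, m < 0 ∧ 0 < p ∧ (4 * s ^ 2 + r ^ 2) * (m + p) = 4 * s * r * (s - y₀) ∧
      (4 * s ^ 2 + r ^ 2) * (m * p) = -(4 * s ^ 2 * (h ^ 2 - y₀ ^ 2)) ∧
      VertexConfig Z d e (2 * s * (h - y₀)) (2 * s * (h + y₀)) (-(2 * r * m)) (2 * r * p) := by
  subst hhH
  have hα : 0 < 4 * s ^ 2 + r ^ 2 := by positivity
  obtain ⟨m, p, hm, hp, hsum, hprod⟩ := exists_roots (β := 4 * s * r * (s - y₀)) hα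
    (show 0 < 4 * s ^ 2 * (h ^ 2 - y₀ ^ 2) from mul_pos (by positivity) (by linarith))
  obtain ⟨hlo, hhi⟩ := abs_lt_of_sq_lt_sq' hin hh.le
  -- The line y = y₀ + rx/(2s) is where the second and third residuals agree; restricted to it, the
  -- second residual is a quadratic in x with roots m and p.
  have hpoly : ∀ x, 4 * s ^ 2 * (x ^ 2 + (y₀ + r * x / (2 * s)) ^ 2 - h ^ 2 - r * x)
      = (4 * s ^ 2 + r ^ 2) * ((x - m) * (x - p)) := by
    intro x
    have : 4 * s ^ 2 * (x ^ 2 + (y₀ + r * x / (2 * s)) ^ 2 - h ^ 2 - r * x)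
      = (4 * s ^ 2 + r ^ 2) * x ^ 2 - 4 * s * r * (s - y₀) * x - 4 * s ^ 2 * (h ^ 2 - y₀ ^ 2) := by
      field_simp; ring
    rw [this]
    linear_combination x * hsum - hprod
  have hroot : ∀ x, x ^ 2 + (y₀ + r * x / (2 * s)) ^ 2 - h ^ 2 - r * x = 0 ↔ x = m ∨ x = p := by
    intro x
    rw [← sub_eq_zero (b := m), ← sub_eq_zero (b := p), ← mul_eq_zero (a := x - m)]
    have := hpoly x
    constructor
    · intro hx
      rw [hx, mul_zero] at this
      exact (mul_eq_zero.1 this.symm).resolve_left hα.ne'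
    · intro hx
      rw [hx, mul_zero] at this
      exact (mul_eq_zero.1 this).resolve_left (by positivity)
  have hm0 := (hroot m).2 (Or.inl rfl)
  have hp0 := (hroot p).2 (Or.inr rfl)
  -- The order is S₁₂±, S₂₃±, S₃₁±; the last pair is the reflection of the middle one.
  obtain ⟨v, hv⟩ : ∃ v : Fin 6 → ℝ × ℝ, v = ![(0, h), (0, -h), (m, y₀ + r * m / (2 * s)),
    (p, y₀ + r * p / (2 * s)), (-m, y₀ + r * m / (2 * s)), (-p, y₀ + r * p / (2 * s))] := ⟨_, rfl⟩
  obtain ⟨e, he⟩ : ∃ e : Fin 6 → Plane, e = φ.symm ∘ v := ⟨_, rfl⟩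
  have hφe : ∀ i, φ (e i) = v i := fun i => by rw [he]; simp
  have inj : Function.Injective e := by
    rw [he]
    refine φ.symm.injective.comp ?_
    have n1 : h ≠ -h := by linarith
    have n2 : (0 : ℝ) ≠ m := hm.ne'
    have n3 : (0 : ℝ) ≠ p := hp.ne
    have n4 : m ≠ p := by linarith
    have n5 : m ≠ -m := by linarith
    have n6 : p ≠ -p := by linarith
    have n7 : (0 : ℝ) ≠ -m := by linarith
    have n8 : (0 : ℝ) ≠ -p := by linarith
    have n9 : r * m / (2 * s) ≠ r * p / (2 * s) := by
      intro hmp; field_simp at hmp; exact n4 hmp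
    rw [hv]
    intro i j
    fin_cases i <;> fin_cases j <;>
      simp [n1, n2, n3, n4, n5, n6, n7, n8, n9, n1.symm, n2.symm, n3.symm, n4.symm, n5.symm,
        n6.symm, n7.symm, n8.symm, n9.symm]
  have on : ∀ i W, W ∈ Metric.sphere (Z i) (d i) ↔ dist W (Z i) ^ 2 - d i ^ 2 = 0 := by
    intro i W
    rw [Metric.mem_sphere, sub_eq_zero, sq_eq_sq₀ dist_nonneg (hd i).le]
  have eqe : ∀ W i, W = e i ↔ (φ W).1 = (v i).1 ∧ (φ W).2 = (v i).2 := by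
    intro W i
    rw [← Prod.ext_iff, ← hφe, φ.apply_eq_iff_eq]
  have c01 : circleInter Z d 0 1 = {e 0, e 1} := by
    ext W
    rw [circleInter, Set.mem_inter_iff, on, on, h0, h1, Set.mem_insert_iff, Set.mem_singleton_iff,
      eqe, eqe, hv]
    generalize (φ W).1 = x
    generalize (φ W).2 = y
    simp only [Matrix.cons_val]
    rw [← and_or_left, ← sq_eq_sq_iff_eq_or_eq_neg]
    constructor
    · rintro ⟨a, b⟩
      have hx : x = 0 := by
        have : r * x = 0 := by linarith
        exact (mul_eq_zero.1 this).resolve_left hr.ne'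
      subst hx
      exact ⟨rfl, by linarith⟩
    · rintro ⟨rfl, b⟩
      constructor <;> linarith
  have c12 : circleInter Z d 1 2 = {e 2, e 3} := by
    ext W
    rw [circleInter, Set.mem_inter_iff, on, on, h1, h2, Set.mem_insert_iff, Set.mem_singleton_iff,
      eqe, eqe, hv]
    generalize (φ W).1 = x
    generalize (φ W).2 = y
    simp only [Matrix.cons_val]
    constructor
    · rintro ⟨a, b⟩
      have hy : y = y₀ + r * x / (2 * s) := by field_simp; linarith
      subst hy
      rcases (hroot x).1 a with rfl | rfl
      · exact Or.inl ⟨rfl, rfl⟩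
      · exact Or.inr ⟨rfl, rfl⟩
    · rintro (⟨rfl, rfl⟩ | ⟨rfl, rfl⟩)
      · refine ⟨hm0, ?_⟩
        rw [← hm0]; field_simp; ring
      · refine ⟨hp0, ?_⟩
        rw [← hp0]; field_simp; ring
  have c20 : circleInter Z d 2 0 = {e 4, e 5} := by
    ext W
    rw [circleInter, Set.mem_inter_iff, on, on, h0, h2, Set.mem_insert_iff, Set.mem_singleton_iff,
      eqe, eqe, hv]
    generalize (φ W).1 = x
    generalize (φ W).2 = y
    simp only [Matrix.cons_val]
    constructor
    · rintro ⟨b, a⟩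
      have hy : y = y₀ + r * (-x) / (2 * s) := by field_simp; linarith
      subst hy
      rcases (hroot (-x)).1 (by linarith) with hx | hx
      · rw [← hx]; exact Or.inl ⟨by ring, rfl⟩
      · rw [← hx]; exact Or.inr ⟨by ring, rfl⟩
    · rintro (⟨rfl, rfl⟩ | ⟨rfl, rfl⟩)
      · refine ⟨?_, by linarith⟩
        rw [← hm0]; field_simp; ring
      · refine ⟨?_, by linarith⟩
        rw [← hp0]; field_simp; ring
  have lt_of : ∀ {i j k}, dist (e i) (Z k) ^ 2 - d k ^ 2 < dist (e j) (Z k) ^ 2 - d k ^ 2 →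
      dist (e i) (Z k) < dist (e j) (Z k) := by
    intro i j k hlt
    exact lt_of_pow_lt_pow_left₀ 2 dist_nonneg (by linarith)
  have l01 : dist (e 0) (Z 2) < dist (e 1) (Z 2) := by
    apply lt_of
    rw [h2, h2, hφe, hφe, hv]
    simp only [Matrix.cons_val]
    nlinarith [mul_pos hs hh]
  -- On the second circle the first residual is 2rx, so the negative root gives the point nearer to
  -- the first sensor.
  have l12 : dist (e 2) (Z 0) < dist (e 3) (Z 0) := by
    apply lt_of
    rw [h0, h0, hφe, hφe, hv]
    simp only [Matrix.cons_val]
    nlinarith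
  have l20 : dist (e 4) (Z 1) < dist (e 5) (Z 1) := by
    apply lt_of
    rw [h1, h1, hφe, hφe, hv]
    simp only [Matrix.cons_val]
    nlinarith
  have val : ∀ i, objective Z d (e i) = ![2 * s * (h - y₀), 2 * s * (h + y₀), -(2 * r * m),
      2 * r * p, -(2 * r * m), 2 * r * p] i := by
    intro i
    rw [objective_eq h0 h1 h2, hφe, hv]
    fin_cases i <;> simp only [Fin.zero_eta, Fin.mk_one, Fin.reduceFinMk, Matrix.cons_val]
    · rw [show (0 : ℝ) ^ 2 + h ^ 2 - h ^ 2 + r * 0 = 0 by ring,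
        show (0 : ℝ) ^ 2 + h ^ 2 - h ^ 2 - r * 0 = 0 by ring,
        show (0 : ℝ) ^ 2 + h ^ 2 - h ^ 2 - 2 * s * (h - y₀) = -(2 * s * (h - y₀)) by ring,
        abs_neg, abs_zero, abs_of_pos (mul_pos (by positivity) (by linarith))]
      ring
    · rw [show (0 : ℝ) ^ 2 + (-h) ^ 2 - h ^ 2 + r * 0 = 0 by ring,
        show (0 : ℝ) ^ 2 + (-h) ^ 2 - h ^ 2 - r * 0 = 0 by ring,
        show (0 : ℝ) ^ 2 + (-h) ^ 2 - h ^ 2 - 2 * s * (-h - y₀) = 2 * s * (h + y₀) by ring,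
        abs_zero, abs_of_pos (mul_pos (by positivity) (by linarith))]
      ring
    · rw [hm0, show m ^ 2 + (y₀ + r * m / (2 * s)) ^ 2 - h ^ 2 + r * m = 2 * r * m by linarith,
        show m ^ 2 + (y₀ + r * m / (2 * s)) ^ 2 - h ^ 2 - 2 * s * (y₀ + r * m / (2 * s) - y₀) = 0 by
          rw [← hm0]; field_simp; ring, abs_zero, abs_of_neg (by nlinarith)]
      ring
    · rw [hp0, show p ^ 2 + (y₀ + r * p / (2 * s)) ^ 2 - h ^ 2 + r * p = 2 * r * p by linarith,
        show p ^ 2 + (y₀ + r * p / (2 * s)) ^ 2 - h ^ 2 - 2 * s * (y₀ + r * p / (2 * s) - y₀) = 0 by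
          rw [← hp0]; field_simp; ring, abs_zero, abs_of_pos (by positivity)]
      ring
    · rw [show (-m) ^ 2 + (y₀ + r * m / (2 * s)) ^ 2 - h ^ 2 + r * -m = 0 by linarith,
        show (-m) ^ 2 + (y₀ + r * m / (2 * s)) ^ 2 - h ^ 2 - r * -m = 2 * r * m by linarith,
        show (-m) ^ 2 + (y₀ + r * m / (2 * s)) ^ 2 - h ^ 2
          - 2 * s * (y₀ + r * m / (2 * s) - y₀) = 0 by
          rw [← hm0]; field_simp; ring, abs_zero, abs_of_neg (by nlinarith)]
      ring
    · rw [show (-p) ^ 2 + (y₀ + r * p / (2 * s)) ^ 2 - h ^ 2 + r * -p = 0 by linarith,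
        show (-p) ^ 2 + (y₀ + r * p / (2 * s)) ^ 2 - h ^ 2 - r * -p = 2 * r * p by linarith,
        show (-p) ^ 2 + (y₀ + r * p / (2 * s)) ^ 2 - h ^ 2
          - 2 * s * (y₀ + r * p / (2 * s) - y₀) = 0 by
          rw [← hp0]; field_simp; ring, abs_zero, abs_of_pos (by positivity)]
      ring
  have vertex : ∀ i, (∀ j, objective Z d (e i) ≤ objective Z d (e j)) →
      ∀ W, objective Z d W ≤ objective Z d (e i) → ∃ k, W = e k := by
    intro i hi W hW
    have b0 := (hi 0).trans_eq (val 0)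
    have b1 := (hi 1).trans_eq (val 1)
    have b2 := (hi 2).trans_eq (val 2)
    have b3 := (hi 3).trans_eq (val 3)
    simp only [Matrix.cons_val] at b0 b1 b2 b3
    have hc : 0 < objective Z d (e i) := by
      rw [val]
      have v0 : 0 < 2 * s * (h - y₀) := mul_pos (by positivity) (by linarith)
      have v1 : 0 < 2 * s * (h + y₀) := mul_pos (by positivity) (by linarith)
      have v2 : 0 < -(2 * r * m) := by nlinarith
      have v3 : 0 < 2 * r * p := by positivity
      fin_cases i <;> assumption
    generalize objective Z d (e i) = c at *
    rw [objective_eq h0 h1 h2] at hW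
    have hk : c / (2 * s) ≤ h - y₀ := by rw [div_le_iff₀ (by positivity)]; linarith
    have hk' : c / (2 * s) ≤ h + y₀ := by rw [div_le_iff₀ (by positivity)]; linarith
    have hl : c / (2 * r) ≤ -m := by rw [div_le_iff₀ (by positivity)]; linarith
    have hl' : c / (2 * r) ≤ p := by rw [div_le_iff₀ (by positivity)]; linarith
    have hk0 : 0 < c / (2 * s) := by positivity
    have hl0 : 0 < c / (2 * r) := by positivity
    have key := vertex_of_l1_le hr hs hc hin ?_ ?_ hW
    · rw [← h0, ← h1, ← h2, ← on, ← on, ← on] at key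
      rcases key with hk | hk | hk
      · have : W ∈ circleInter Z d 1 2 := hk
        rw [c12] at this
        rcases this with hw | hw
        exacts [⟨_, hw⟩, ⟨_, hw⟩]
      · have : W ∈ circleInter Z d 2 0 := hk.symm
        rw [c20] at this
        rcases this with hw | hw
        exacts [⟨_, hw⟩, ⟨_, hw⟩]
      · have : W ∈ circleInter Z d 0 1 := hk
        rw [c01] at this
        rcases this with hw | hw
        exacts [⟨_, hw⟩, ⟨_, hw⟩]
    · intro σ hσ
      rw [mul_div_assoc]
      apply sq_le_sq'
      · rcases hσ with rfl | rfl <;> linarith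
      · rcases hσ with rfl | rfl <;> linarith
    · intro σ hσ
      -- A vertex with coordinate σc projects to abscissa x = σc/(2r) on the radical axis. Since c
      -- is at most −2rm and 2rp, x lies between the roots, where the quadratic is nonpositive.
      obtain ⟨x, hx⟩ : ∃ x, x = σ * c / (2 * r) := ⟨_, rfl⟩
      have hx1 : m ≤ x := by
        rw [hx, mul_div_assoc]
        rcases hσ with rfl | rfl <;> linarith
      have hx2 : x ≤ p := by
        rw [hx, mul_div_assoc]
        rcases hσ with rfl | rfl <;> linarith
      have e1 : σ * c / (4 * s) = r * x / (2 * s) := by rw [hx]; field_simp; ring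
      have e2 : σ * c / 2 = r * x := by rw [hx]; field_simp
      rw [e1, e2, ← hx]
      have hle : (4 * s ^ 2 + r ^ 2) * ((x - m) * (x - p)) ≤ 0 :=
        mul_nonpos_of_nonneg_of_nonpos hα.le
          (mul_nonpos_of_nonneg_of_nonpos (by linarith) (by linarith))
      rw [← hpoly] at hle
      have := nonpos_of_mul_nonpos_right hle (show 0 < 4 * s ^ 2 by positivity)
      linarith
  refine ⟨e, m, p, hm, hp, hsum, hprod, inj, nearPt_eq_singleton c01 l01,
    farPt_eq_singleton c01 l01, nearPt_eq_singleton c12 l12, farPt_eq_singleton c12 l12,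
    nearPt_eq_singleton c20 l20, farPt_eq_singleton c20 l20, val, fun W => ?_⟩
  simp only [← val]
  constructor
  · intro hW
    have hW' : ∀ q, objective Z d W ≤ objective Z d q := fun q => hW (Set.mem_univ q)
    obtain ⟨i, -, hi⟩ := Finset.exists_min_image Finset.univ (fun i => objective Z d (e i))
      Finset.univ_nonempty
    obtain ⟨k, rfl⟩ := vertex i (fun j => hi j (Finset.mem_univ j)) W (hW' _)
    exact ⟨k, rfl, fun j => hW' _⟩
  · rintro ⟨i, rfl, hi⟩ q -
    by_contra hq
    rw [Set.mem_ofPred_eq, not_le] at hq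
    obtain ⟨k, rfl⟩ := vertex i hi q hq.le
    exact hq.not_ge (hi k)

end Coordinates

/-! ### Comparing the four values -/

theorem mul_neg_iff_of_pos_left {a b : ℝ} (ha : 0 < a) : a * b < 0 ↔ b < 0 := by
  rw [← neg_pos, ← mul_neg, mul_pos_iff_of_pos_left ha, neg_pos]

theorem sign_iff_of_mul_eq {a b k l : ℝ} (hk : 0 < k) (hl : 0 < l) (h : a * k = l * b) :
    (a < 0 ↔ b < 0) ∧ (a = 0 ↔ b = 0) ∧ (0 < a ↔ 0 < b) := by
  refine ⟨?_, ?_, ?_⟩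
  · rw [← mul_neg_iff_of_pos_left hk, mul_comm, h, mul_neg_iff_of_pos_left hl]
  · constructor
    · rintro rfl
      exact (mul_eq_zero.1 (by linarith : l * b = 0)).resolve_left hl.ne'
    · rintro rfl
      exact (mul_eq_zero.1 (by linarith : a * k = 0)).resolve_right hk.ne'
  · rw [← mul_pos_iff_of_pos_right hk, h, mul_pos_iff_of_pos_left hl]

/-- The comparisons between the four values of the objective. -/
theorem value_signs {r s h y₀ m p : ℝ} (hr : 0 < r) (hs : 0 < s) (hlo : -h < y₀) (hhi : y₀ < h)
    (hm : m < 0) (hp : 0 < p) (hsum : (4 * s ^ 2 + r ^ 2) * (m + p) = 4 * s * r * (s - y₀))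
    (hprod : (4 * s ^ 2 + r ^ 2) * (m * p) = -(4 * s ^ 2 * (h ^ 2 - y₀ ^ 2)))
    {Ap Am Bp Bm : ℝ} (hAp : Ap = 2 * s * (h - y₀)) (hAm : Am = 2 * s * (h + y₀))
    (hBp : Bp = -(2 * r * m)) (hBm : Bm = 2 * r * p) {D T : ℝ} (hD : D = 4 * s ^ 2 - 3 * r ^ 2)
    (hT : T = D * h + 4 * r ^ 2 * s) :
    ((Am - Ap < 0 ↔ y₀ < 0) ∧ (Am - Ap = 0 ↔ y₀ = 0) ∧ (0 < Am - Ap ↔ 0 < y₀)) ∧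
    ((Bm - Bp < 0 ↔ s - y₀ < 0) ∧ (Bm - Bp = 0 ↔ s - y₀ = 0) ∧ (0 < Bm - Bp ↔ 0 < s - y₀)) ∧
    ((Ap - Bp < 0 ↔ T - (4 * s ^ 2 + 9 * r ^ 2) * y₀ < 0) ∧
      (Ap - Bp = 0 ↔ T - (4 * s ^ 2 + 9 * r ^ 2) * y₀ = 0) ∧
      (0 < Ap - Bp ↔ 0 < T - (4 * s ^ 2 + 9 * r ^ 2) * y₀)) ∧
    ((Am - Bp < 0 ↔ T + (4 * s ^ 2 + r ^ 2) * y₀ < 0) ∧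
      (Am - Bp = 0 ↔ T + (4 * s ^ 2 + r ^ 2) * y₀ = 0) ∧
      (0 < Am - Bp ↔ 0 < T + (4 * s ^ 2 + r ^ 2) * y₀)) ∧
    ((Ap - Bm < 0 ↔ (4 * s ^ 2 + r ^ 2) * (h - y₀) - 4 * r ^ 2 * (s + h) < 0) ∧
      (Ap - Bm = 0 ↔ (4 * s ^ 2 + r ^ 2) * (h - y₀) - 4 * r ^ 2 * (s + h) = 0) ∧
      (0 < Ap - Bm ↔ 0 < (4 * s ^ 2 + r ^ 2) * (h - y₀) - 4 * r ^ 2 * (s + h))) := by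
  have hα : 0 < 4 * s ^ 2 + r ^ 2 := by positivity
  have a0 : 0 < Ap := by rw [hAp]; exact mul_pos (by positivity) (by linarith)
  have a1 : 0 < Am := by rw [hAm]; exact mul_pos (by positivity) (by linarith)
  have b0 : 0 < Bp := by rw [hBp]; nlinarith
  have b1 : 0 < Bm := by rw [hBm]; positivity
  have u0 : 0 < 4 * s ^ 2 * (h - y₀) := mul_pos (by positivity) (by linarith)
  have u1 : 0 < 4 * s ^ 2 * (h + y₀) := mul_pos (by positivity) (by linarith)
  -- The last three comparisons evaluate the quadratic with roots m, p at ±A/(2r), where A is `Ap`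
  -- or `Am`. For instance (Ap − Bp)(Ap + Bm) = 4r²(x − m)(x − p) at x = −Ap/(2r). The factor h − y₀
  -- (or h + y₀) of A also divides the constant term, and the quotient is affine in y₀.
  refine ⟨sign_iff_of_mul_eq (k := 1) (l := 4 * s) one_pos (by positivity) ?_,
    sign_iff_of_mul_eq (l := 8 * s * r ^ 2) hα (by positivity) ?_,
    sign_iff_of_mul_eq (k := (Ap + Bm) * (4 * s ^ 2 + r ^ 2)) (by positivity) u0 ?_,
    sign_iff_of_mul_eq (k := (Am + Bm) * (4 * s ^ 2 + r ^ 2)) (by positivity) u1 ?_,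
    sign_iff_of_mul_eq (k := (Ap + Bp) * (4 * s ^ 2 + r ^ 2)) (by positivity) u0 ?_⟩
  · rw [hAp, hAm]; ring
  · rw [hBp, hBm]; linear_combination 2 * r * hsum
  · rw [hAp, hBp, hBm, hT, hD]
    linear_combination 4 * r * s * (h - y₀) * hsum + 4 * r ^ 2 * hprod
  · rw [hAm, hBp, hBm, hT, hD]
    linear_combination 4 * r * s * (h + y₀) * hsum + 4 * r ^ 2 * hprod
  · rw [hAp, hBp, hBm]
    linear_combination -4 * r * s * (h - y₀) * hsum + 4 * r ^ 2 * hprod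

/-! ### From values to sets of minimizers -/

/-- Since the six points are distinct, an equality of sets of points reduces to an equality of sets
of indices. -/
theorem consistsOf_iff {X : Set Plane} {e : Fin 6 → Plane} {v : Fin 6 → ℝ}
    (hinj : Function.Injective e) (hX : ∀ W, W ∈ X ↔ ∃ i, W = e i ∧ ∀ j, v i ≤ v j)
    {n : ℕ} {A : Fin n → Set Plane} {ι : Fin n → Fin 6} (hι : Function.Injective ι)
    (hA : ∀ k, A k = {e (ι k)}) :
    ConsistsOf X A ↔ ∀ i, (∀ j, v i ≤ v j) ↔ ∃ k, ι k = i := by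
  have hXe : ∀ i, e i ∈ X ↔ ∀ j, v i ≤ v j := by
    intro i
    rw [hX]
    constructor
    · rintro ⟨k, hk, h⟩
      rwa [hinj hk]
    · exact fun h => ⟨i, rfl, h⟩
  constructor
  · rintro ⟨p, -, hp, rfl⟩ i
    have hpe : ∀ k, p k = e (ι k) := fun k => by simpa [hA] using hp k
    rw [← hXe, Set.mem_range]
    simp only [hpe, hinj.eq_iff]
  · intro h
    refine ⟨e ∘ ι, hinj.comp hι, fun k => by simp [hA], ?_⟩
    ext W
    rw [hX]
    constructor
    · rintro ⟨i, rfl, hi⟩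
      obtain ⟨k, rfl⟩ := (h i).1 hi
      exact ⟨k, rfl⟩
    · rintro ⟨k, rfl⟩
      exact ⟨ι k, rfl, (h _).2 ⟨k, rfl⟩⟩

theorem ConsistsOf.nontrivial {X : Set Plane} {n : ℕ} {A : Fin (n + 2) → Set Plane}
    (h : ConsistsOf X A) : X.Nontrivial := by
  obtain ⟨p, hp, -, rfl⟩ := h
  exact ⟨p 0, ⟨0, rfl⟩, p 1, ⟨1, rfl⟩, hp.ne (by simp)⟩

theorem forall_min_iff {Ap Am Bp Bm : ℝ} {Q : Fin 6 → Prop} :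
    (∀ i, (∀ j, ![Ap, Am, Bp, Bm, Bp, Bm] i ≤ ![Ap, Am, Bp, Bm, Bp, Bm] j) ↔ Q i) ↔
      ((Ap ≤ Am ∧ Ap ≤ Bp ∧ Ap ≤ Bm) ↔ Q 0) ∧ ((Am ≤ Ap ∧ Am ≤ Bp ∧ Am ≤ Bm) ↔ Q 1) ∧
      ((Bp ≤ Ap ∧ Bp ≤ Am ∧ Bp ≤ Bm) ↔ Q 2) ∧ ((Bm ≤ Ap ∧ Bm ≤ Am ∧ Bm ≤ Bp) ↔ Q 3) ∧
      ((Bp ≤ Ap ∧ Bp ≤ Am ∧ Bp ≤ Bm) ↔ Q 4) ∧ ((Bm ≤ Ap ∧ Bm ≤ Am ∧ Bm ≤ Bp) ↔ Q 5) := by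
  have key : ∀ P : Fin 6 → Prop, (∀ i, P i) ↔ P 0 ∧ P 1 ∧ P 2 ∧ P 3 ∧ P 4 ∧ P 5 := by
    intro P
    simp [Fin.forall_fin_succ]
  simp only [key, Matrix.cons_val, le_refl, true_and, and_true]
  have e1 : (Ap ≤ Am ∧ Ap ≤ Bp ∧ Ap ≤ Bm ∧ Ap ≤ Bp ∧ Ap ≤ Bm) ↔ (Ap ≤ Am ∧ Ap ≤ Bp ∧ Ap ≤ Bm) := by
    tauto
  have e2 : (Am ≤ Ap ∧ Am ≤ Bp ∧ Am ≤ Bm ∧ Am ≤ Bp ∧ Am ≤ Bm) ↔ (Am ≤ Ap ∧ Am ≤ Bp ∧ Am ≤ Bm) := by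
    tauto
  have e3 : (Bp ≤ Ap ∧ Bp ≤ Am ∧ Bp ≤ Bm ∧ Bp ≤ Bm) ↔ (Bp ≤ Ap ∧ Bp ≤ Am ∧ Bp ≤ Bm) := by
    tauto
  have e4 : (Bm ≤ Ap ∧ Bm ≤ Am ∧ Bm ≤ Bp ∧ Bm ≤ Bp) ↔ (Bm ≤ Ap ∧ Bm ≤ Am ∧ Bm ≤ Bp) := by
    tauto
  rw [e1, e2, e3, e4]

/-- The nine possible sets of minimizers in terms of the values of the objective. -/
theorem VertexConfig.consistsOf {Z : Fin 3 → Plane} {d : Fin 3 → ℝ} {e : Fin 6 → Plane}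
    {Ap Am Bp Bm : ℝ} (c : VertexConfig Z d e Ap Am Bp Bm) (hord : Bm ≤ Bp → Ap < Am) :
    (ConsistsOf (minimizers Z d) ![S12p Z d, S23p Z d, S23m Z d, S31p Z d, S31m Z d] ↔
      Bm - Bp = 0 ∧ Ap - Bp = 0) ∧
    (ConsistsOf (minimizers Z d) ![S23p Z d, S23m Z d, S31p Z d, S31m Z d] ↔
      Bm - Bp = 0 ∧ 0 < Ap - Bp) ∧
    (ConsistsOf (minimizers Z d) ![S12p Z d, S12m Z d, S23p Z d, S31p Z d] ↔
      Am - Ap = 0 ∧ Ap - Bp = 0) ∧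
    (ConsistsOf (minimizers Z d) ![S12m Z d, S23p Z d, S31p Z d] ↔
      Am - Ap < 0 ∧ Am - Bp = 0) ∧
    (ConsistsOf (minimizers Z d) ![S12p Z d, S23m Z d, S31m Z d] ↔
      Bm - Bp < 0 ∧ Ap - Bm = 0) ∧
    (ConsistsOf (minimizers Z d) ![S12p Z d, S23p Z d, S31p Z d] ↔
      0 < Am - Ap ∧ 0 < Bm - Bp ∧ Ap - Bp = 0) ∧
    (ConsistsOf (minimizers Z d) ![S12p Z d, S12m Z d] ↔ Am - Ap = 0 ∧ Ap - Bp < 0) ∧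
    (ConsistsOf (minimizers Z d) ![S23m Z d, S31m Z d] ↔ Bm - Bp < 0 ∧ 0 < Ap - Bm) ∧
    (ConsistsOf (minimizers Z d) ![S23p Z d, S31p Z d] ↔
      0 < Bm - Bp ∧ 0 < Ap - Bp ∧ 0 < Am - Bp) := by
  obtain ⟨inj, s0, s1, s2, s3, s4, s5, -, mem⟩ := c
  refine ⟨?_, ?_, ?_, ?_, ?_, ?_, ?_, ?_, ?_⟩
  · rw [consistsOf_iff (ι := ![0, 2, 3, 4, 5]) inj mem (by decide)
      (by intro k; fin_cases k <;> simp [s0, s2, s3, s4, s5]), forall_min_iff]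
    simp [Fin.exists_fin_succ]
    grind
  · rw [consistsOf_iff (ι := ![2, 3, 4, 5]) inj mem (by decide)
      (by intro k; fin_cases k <;> simp [s2, s3, s4, s5]), forall_min_iff]
    simp [Fin.exists_fin_succ]
    grind
  · rw [consistsOf_iff (ι := ![0, 1, 2, 4]) inj mem (by decide)
      (by intro k; fin_cases k <;> simp [s0, s1, s2, s4]), forall_min_iff]
    simp [Fin.exists_fin_succ]
    grind
  · rw [consistsOf_iff (ι := ![1, 2, 4]) inj mem (by decide)
      (by intro k; fin_cases k <;> simp [s1, s2, s4]), forall_min_iff]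
    simp [Fin.exists_fin_succ]
    grind
  · rw [consistsOf_iff (ι := ![0, 3, 5]) inj mem (by decide)
      (by intro k; fin_cases k <;> simp [s0, s3, s5]), forall_min_iff]
    simp [Fin.exists_fin_succ]
    grind
  · rw [consistsOf_iff (ι := ![0, 2, 4]) inj mem (by decide)
      (by intro k; fin_cases k <;> simp [s0, s2, s4]), forall_min_iff]
    simp [Fin.exists_fin_succ]
    grind
  · rw [consistsOf_iff (ι := ![0, 1]) inj mem (by decide)
      (by intro k; fin_cases k <;> simp [s0, s1]), forall_min_iff]
    simp
    grind
  · rw [consistsOf_iff (ι := ![3, 5]) inj mem (by decide)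
      (by intro k; fin_cases k <;> simp [s3, s5]), forall_min_iff]
    simp
    grind
  · rw [consistsOf_iff (ι := ![2, 4]) inj mem (by decide)
      (by intro k; fin_cases k <;> simp [s2, s4]), forall_min_iff]
    simp
    grind

/-- If the minimizer is not unique, then one of the nine patterns of values occurs. -/
theorem VertexConfig.pattern_of_nontrivial {Z : Fin 3 → Plane} {d : Fin 3 → ℝ}
    {e : Fin 6 → Plane} {Ap Am Bp Bm : ℝ} (c : VertexConfig Z d e Ap Am Bp Bm)
    (hord : Bm ≤ Bp → Ap < Am) (hX : (minimizers Z d).Nontrivial) :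
    (Bm - Bp = 0 ∧ Ap - Bp = 0) ∨ (Bm - Bp = 0 ∧ 0 < Ap - Bp) ∨ (Am - Ap = 0 ∧ Ap - Bp = 0) ∨
    (Am - Ap < 0 ∧ Am - Bp = 0) ∨ (Bm - Bp < 0 ∧ Ap - Bm = 0) ∨
    (0 < Am - Ap ∧ 0 < Bm - Bp ∧ Ap - Bp = 0) ∨ (Am - Ap = 0 ∧ Ap - Bp < 0) ∨
    (Bm - Bp < 0 ∧ 0 < Ap - Bm) ∨ (0 < Bm - Bp ∧ 0 < Ap - Bp ∧ 0 < Am - Bp) := by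
  -- Values off the axis of symmetry occur twice, so a unique minimizer arises only when `Ap` or
  -- `Am` is strictly the least. Apart from these two cases, `hord` leaves nine patterns.
  have hp : ¬ (Ap < Am ∧ Ap < Bp ∧ Ap < Bm) := by
    rintro ⟨h1, h2, h3⟩
    obtain ⟨x, hx, y, hy, hxy⟩ := hX
    have only : ∀ W ∈ minimizers Z d, W = e 0 := by
      intro W hW
      obtain ⟨i, rfl, hi⟩ := (c.mem W).1 hW
      have := hi 0
      fin_cases i <;> simp at this <;> first | rfl | linarith
    exact hxy ((only x hx).trans (only y hy).symm)
  have hm : ¬ (Am < Ap ∧ Am < Bp ∧ Am < Bm) := by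
    rintro ⟨h1, h2, h3⟩
    obtain ⟨x, hx, y, hy, hxy⟩ := hX
    have only : ∀ W ∈ minimizers Z d, W = e 1 := by
      intro W hW
      obtain ⟨i, rfl, hi⟩ := (c.mem W).1 hW
      have := hi 1
      fin_cases i <;> simp at this <;> first | rfl | linarith
    exact hxy ((only x hx).trans (only y hy).symm)
  grind (splits := 20)

/-! ### Thresholds for d₁ and d₃ as conditions on h and y₀ -/

theorem eq_sqrt_iff_of_pos {a b : ℝ} (ha : 0 < a) : a = √b ↔ a ^ 2 = b := by
  rw [eq_comm, Real.sqrt_eq_iff_mul_self_eq_of_pos ha, sq]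

theorem sqrt_three_lt_iff {r s : ℝ} (hr : 0 < r) (hs : 0 < s) :
    √3 / 2 * r < s ↔ 0 < 4 * s ^ 2 - 3 * r ^ 2 := by
  rw [← pow_lt_pow_iff_left₀ (by positivity) hs.le two_ne_zero, mul_pow, div_pow,
    Real.sq_sqrt (by norm_num)]
  constructor <;> intro h <;> linarith

theorem lt_sqrt_three_iff {r s : ℝ} (hr : 0 < r) (hs : 0 < s) :
    s < √3 / 2 * r ↔ 4 * s ^ 2 - 3 * r ^ 2 < 0 := by
  rw [← pow_lt_pow_iff_left₀ hs.le (by positivity) two_ne_zero, mul_pow, div_pow,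
    Real.sq_sqrt (by norm_num)]
  constructor <;> intro h <;> linarith

theorem eq_sqrt_three_iff {r s : ℝ} (hr : 0 < r) (hs : 0 < s) :
    s = √3 / 2 * r ↔ 4 * s ^ 2 - 3 * r ^ 2 = 0 := by
  rw [← sq_eq_sq₀ hs.le (by positivity), mul_pow, div_pow, Real.sq_sqrt (by norm_num)]
  constructor <;> intro h <;> linarith

section Thresholds

variable {r s t h d₁ d₃ y₀ : ℝ}

theorem half_lt_sqrt (hr : 0 < r) (ht : 0 < t) : r / 2 < √(r ^ 2 / 4 + t ^ 2) := by
  rw [Real.lt_sqrt (by positivity)]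
  have : 0 < t ^ 2 := by positivity
  linarith

theorem sqrt_lt_iff (hd : 0 < d₁) (ht : 0 < t) (hh : 0 < h) (hH : d₁ ^ 2 - r ^ 2 / 4 = h ^ 2) :
    √(r ^ 2 / 4 + t ^ 2) < d₁ ↔ t < h := by
  rw [Real.sqrt_lt' hd, ← pow_lt_pow_iff_left₀ ht.le hh.le two_ne_zero]
  constructor <;> intro h <;> linarith

theorem lt_sqrt_iff (hd : 0 < d₁) (ht : 0 < t) (hh : 0 < h) (hH : d₁ ^ 2 - r ^ 2 / 4 = h ^ 2) :
    d₁ < √(r ^ 2 / 4 + t ^ 2) ↔ h < t := by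
  rw [Real.lt_sqrt hd.le, ← pow_lt_pow_iff_left₀ hh.le ht.le two_ne_zero]
  constructor <;> intro h <;> linarith

theorem eq_sqrt_iff (hd : 0 < d₁) (ht : 0 < t) (hh : 0 < h) (hH : d₁ ^ 2 - r ^ 2 / 4 = h ^ 2) :
    d₁ = √(r ^ 2 / 4 + t ^ 2) ↔ h = t := by
  rw [eq_sqrt_iff_of_pos hd, ← sq_eq_sq₀ hh.le ht.le]
  constructor <;> intro h <;> linarith

theorem sharpBound_eq : sharpBound r s = √(r ^ 2 / 4
    + (s * (4 * s ^ 2 + 5 * r ^ 2) / (4 * s ^ 2 - 3 * r ^ 2)) ^ 2) := by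
  rw [sharpBound, mul_div_assoc, mul_pow]

theorem flatBound_eq : flatBound r s = √(r ^ 2 / 4
    + (s * (4 * r ^ 2) / (3 * r ^ 2 - 4 * s ^ 2)) ^ 2) := by
  rw [flatBound, mul_div_assoc s, mul_pow s]

variable (hr : 0 < r) (hs : 0 < s) (hd : 0 < d₁) (hd₃ : 0 < d₃) (hh : 0 < h)
  (hH : d₁ ^ 2 - r ^ 2 / 4 = h ^ 2) (hy : d₃ ^ 2 = h ^ 2 + s ^ 2 - 2 * s * y₀)

-- P is the value of d₁ at which the affine expression comparing S₁₂+ with S₂₃+ vanishes at y₀ = s,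
-- the level where S₂₃+ and S₂₃− tie.
include hr hs hd hh hH in
theorem sharpBound_iff (hD : 0 < 4 * s ^ 2 - 3 * r ^ 2) :
    (sharpBound r s < d₁ ↔ s * (4 * s ^ 2 + 5 * r ^ 2) < (4 * s ^ 2 - 3 * r ^ 2) * h) ∧
    (d₁ < sharpBound r s ↔ (4 * s ^ 2 - 3 * r ^ 2) * h < s * (4 * s ^ 2 + 5 * r ^ 2)) ∧
    (d₁ = sharpBound r s ↔ (4 * s ^ 2 - 3 * r ^ 2) * h = s * (4 * s ^ 2 + 5 * r ^ 2)) := by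
  have ht : 0 < s * (4 * s ^ 2 + 5 * r ^ 2) / (4 * s ^ 2 - 3 * r ^ 2) :=
    div_pos (by positivity) hD
  rw [sharpBound_eq, sqrt_lt_iff hd ht hh hH, lt_sqrt_iff hd ht hh hH, eq_sqrt_iff hd ht hh hH,
    div_lt_iff₀ hD, lt_div_iff₀ hD, eq_div_iff hD.ne', mul_comm h]
  exact ⟨Iff.rfl, Iff.rfl, Iff.rfl⟩

-- F plays the same role at y₀ = 0, the level where S₁₂+ and S₁₂− tie.
include hr hs hd hh hH in
theorem flatBound_iff (hD : 4 * s ^ 2 - 3 * r ^ 2 < 0) :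
    (flatBound r s < d₁ ↔ (4 * s ^ 2 - 3 * r ^ 2) * h + 4 * r ^ 2 * s < 0) ∧
    (d₁ < flatBound r s ↔ 0 < (4 * s ^ 2 - 3 * r ^ 2) * h + 4 * r ^ 2 * s) ∧
    (d₁ = flatBound r s ↔ (4 * s ^ 2 - 3 * r ^ 2) * h + 4 * r ^ 2 * s = 0) := by
  have hD' : 0 < 3 * r ^ 2 - 4 * s ^ 2 := by linarith
  have ht : 0 < s * (4 * r ^ 2) / (3 * r ^ 2 - 4 * s ^ 2) := div_pos (by positivity) hD'
  rw [flatBound_eq, sqrt_lt_iff hd ht hh hH, lt_sqrt_iff hd ht hh hH, eq_sqrt_iff hd ht hh hH,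
    div_lt_iff₀ hD', lt_div_iff₀ hD', eq_div_iff hD'.ne']
  refine ⟨?_, ?_, ?_⟩ <;> constructor <;> intro h <;> linarith

-- For fixed d₁, d₃² is affine and decreasing in y₀, and R² is its value where S₁₂+ and S₂₃+ tie. As
-- d₃ > 0, the sign of the radicand plays no role. M and d₃* are treated in the same way, for the
-- ties of S₁₂− with S₂₃+ and of S₁₂+ with S₂₃−.
include hr hs hd₃ hh hH hy in
theorem constR_iff :
    (constR r s d₁ < d₃ ↔
      0 < (4 * s ^ 2 - 3 * r ^ 2) * h + 4 * r ^ 2 * s - (4 * s ^ 2 + 9 * r ^ 2) * y₀) ∧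
    (d₃ = constR r s d₁ ↔
      (4 * s ^ 2 - 3 * r ^ 2) * h + 4 * r ^ 2 * s - (4 * s ^ 2 + 9 * r ^ 2) * y₀ = 0) := by
  have hk : 0 < 2 * s / (4 * s ^ 2 + 9 * r ^ 2) := by positivity
  have key : d₃ ^ 2 - (h ^ 2 + s ^ 2 * ((4 * s ^ 2 + r ^ 2) / (4 * s ^ 2 + 9 * r ^ 2))
      - 2 * s * h * ((4 * s ^ 2 - 3 * r ^ 2) / (4 * s ^ 2 + 9 * r ^ 2)))
      = 2 * s / (4 * s ^ 2 + 9 * r ^ 2)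
        * ((4 * s ^ 2 - 3 * r ^ 2) * h + 4 * r ^ 2 * s - (4 * s ^ 2 + 9 * r ^ 2) * y₀) := by
    rw [hy]; field_simp; ring
  rw [constR, hH, Real.sqrt_sq hh.le, Real.sqrt_lt' hd₃, eq_sqrt_iff_of_pos hd₃]
  constructor
  · rw [← sub_pos, key, mul_pos_iff_of_pos_left hk]
  · rw [← sub_eq_zero, key, mul_eq_zero, or_iff_right hk.ne']

include hr hs hd₃ hh hH hy in
theorem constM_iff :
    (d₃ < constM r s d₁ ↔
      0 < (4 * s ^ 2 - 3 * r ^ 2) * h + 4 * r ^ 2 * s + (4 * s ^ 2 + r ^ 2) * y₀) ∧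
    (d₃ = constM r s d₁ ↔
      (4 * s ^ 2 - 3 * r ^ 2) * h + 4 * r ^ 2 * s + (4 * s ^ 2 + r ^ 2) * y₀ = 0) := by
  have hk : 0 < 2 * s / (4 * s ^ 2 + r ^ 2) := by positivity
  have key : h ^ 2 + 2 * s * h * ((4 * s ^ 2 - 3 * r ^ 2) / (4 * s ^ 2 + r ^ 2))
      + s ^ 2 * ((4 * s ^ 2 + 9 * r ^ 2) / (4 * s ^ 2 + r ^ 2)) - d₃ ^ 2
      = 2 * s / (4 * s ^ 2 + r ^ 2)
        * ((4 * s ^ 2 - 3 * r ^ 2) * h + 4 * r ^ 2 * s + (4 * s ^ 2 + r ^ 2) * y₀) := by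
    rw [hy]; field_simp; ring
  rw [constM, hH, Real.sqrt_sq hh.le, Real.lt_sqrt hd₃.le, eq_sqrt_iff_of_pos hd₃]
  constructor
  · rw [← sub_pos, key, mul_pos_iff_of_pos_left hk]
  · rw [eq_comm, ← sub_eq_zero, key, mul_eq_zero, or_iff_right hk.ne']

include hr hs hd₃ hh hH hy in
theorem dStar_iff :
    (dStar r s d₁ < d₃ ↔
      0 < (4 * s ^ 2 + r ^ 2) * (h - y₀) - 4 * r ^ 2 * (s + h)) ∧
    (d₃ = dStar r s d₁ ↔
      (4 * s ^ 2 + r ^ 2) * (h - y₀) - 4 * r ^ 2 * (s + h) = 0) := by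
  have hk : 0 < 2 * s / (4 * s ^ 2 + r ^ 2) := by positivity
  have key : d₃ ^ 2 - ((h - s) ^ 2 + 2 * s * r ^ 2 * (h + s) / (s ^ 2 + r ^ 2 / 4))
      = 2 * s / (4 * s ^ 2 + r ^ 2)
        * ((4 * s ^ 2 + r ^ 2) * (h - y₀) - 4 * r ^ 2 * (s + h)) := by
    rw [hy]; field_simp; ring
  rw [dStar, hH, Real.sqrt_sq hh.le, Real.sqrt_lt' hd₃, eq_sqrt_iff_of_pos hd₃]
  constructor
  · rw [← sub_pos, key, mul_pos_iff_of_pos_left hk]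
  · rw [← sub_eq_zero, key, mul_eq_zero, or_iff_right hk.ne']

include hs hd₃ hH hy in
theorem sqrt_sub_iff :
    (d₃ < √(d₁ ^ 2 - r ^ 2 / 4 - s ^ 2) ↔ s - y₀ < 0) ∧
    (√(d₁ ^ 2 - r ^ 2 / 4 - s ^ 2) < d₃ ↔ 0 < s - y₀) ∧
    (d₃ = √(d₁ ^ 2 - r ^ 2 / 4 - s ^ 2) ↔ s - y₀ = 0) := by
  have key : d₃ ^ 2 - (h ^ 2 - s ^ 2) = 2 * s * (s - y₀) := by rw [hy]; ring
  have hk : 0 < 2 * s := by positivity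
  rw [hH, Real.sqrt_lt' hd₃, Real.lt_sqrt hd₃.le, eq_sqrt_iff_of_pos hd₃]
  refine ⟨?_, ?_, ?_⟩
  · rw [← sub_neg, key, mul_neg_iff_of_pos_left hk]
  · rw [← sub_pos, key, mul_pos_iff_of_pos_left hk]
  · rw [← sub_eq_zero, key, mul_eq_zero, or_iff_right hk.ne']

include hs hd₃ hH hy in
theorem eq_sqrt_add_iff : d₃ = √(d₁ ^ 2 - r ^ 2 / 4 + s ^ 2) ↔ y₀ = 0 := by
  rw [hH, eq_sqrt_iff_of_pos hd₃, hy]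
  constructor
  · intro h
    have : s * y₀ = 0 := by linarith
    exact (mul_eq_zero.1 this).resolve_left hs.ne'
  · rintro rfl
    ring

include hs hd₃ hh hy in
theorem lt_add_iff : d₃ < s + h ↔ -h < y₀ := by
  rw [← pow_lt_pow_iff_left₀ hd₃.le (by positivity) two_ne_zero, hy]
  constructor
  · intro hlt
    have : 0 < 2 * s * (y₀ + h) := by linarith
    have := (mul_pos_iff_of_pos_left (show 0 < 2 * s by positivity)).1 this
    linarith
  · intro hlt
    have : 0 < 2 * s * (y₀ + h) := mul_pos (by positivity) (by linarith)
    linarith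

include hs hd₃ hy in
theorem abs_sub_lt_iff : |h - s| < d₃ ↔ y₀ < h := by
  rw [← pow_lt_pow_iff_left₀ (abs_nonneg _) hd₃.le two_ne_zero, sq_abs, hy]
  constructor
  · intro hlt
    have : 0 < 2 * s * (h - y₀) := by linarith
    have := (mul_pos_iff_of_pos_left (show 0 < 2 * s by positivity)).1 this
    linarith
  · intro hlt
    have : 0 < 2 * s * (h - y₀) := mul_pos (by positivity) (by linarith)
    linarith

end Thresholds

/-! ### The nine regions of the (d₁, d₃) plane -/

theorem pos_of_mul_pos_left {k x : ℝ} (hk : 0 < k) (h : 0 < k * x) : 0 < x :=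
  (mul_pos_iff_of_pos_left hk).1 h

section Regions

variable {r s h d₁ d₃ y₀ : ℝ} (hr : 0 < r) (hs : 0 < s) (hd : 0 < d₁) (hd₃ : 0 < d₃) (hh : 0 < h)
  (hH : d₁ ^ 2 - r ^ 2 / 4 = h ^ 2) (hy : d₃ ^ 2 = h ^ 2 + s ^ 2 - 2 * s * y₀)

include hr hs hd hd₃ hh hH hy

theorem region_S12p_S23_S31 :
    ((-h < y₀ ∧ y₀ < h) ∧ s - y₀ = 0 ∧
      (4 * s ^ 2 - 3 * r ^ 2) * h + 4 * r ^ 2 * s - (4 * s ^ 2 + 9 * r ^ 2) * y₀ = 0) ↔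
    (√3 / 2 * r < s ∧ d₁ = sharpBound r s ∧
        d₃ = 4 * s * r / (4 * s ^ 2 - 3 * r ^ 2) * √(4 * s ^ 2 + r ^ 2)) := by
  rw [sqrt_three_lt_iff hr hs]
  have hd3 : ∀ D, 0 < D → (d₃ = 4 * s * r / D * √(4 * s ^ 2 + r ^ 2) ↔
      D ^ 2 * d₃ ^ 2 = (4 * s * r) ^ 2 * (4 * s ^ 2 + r ^ 2)) := by
    intro D hD
    rw [← sq_eq_sq₀ hd₃.le (by positivity), mul_pow, Real.sq_sqrt (by positivity), div_pow,
      div_mul_eq_mul_div, eq_div_iff (by positivity), mul_comm]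
  constructor
  · rintro ⟨⟨h1, h2⟩, h3, h4⟩
    obtain rfl : s = y₀ := by linarith
    have hDh : (4 * s ^ 2 - 3 * r ^ 2) * h = s * (4 * s ^ 2 + 5 * r ^ 2) := by linarith
    have hD : 0 < 4 * s ^ 2 - 3 * r ^ 2 := by
      refine pos_of_mul_pos_left hh ?_
      rw [mul_comm, hDh]; positivity
    refine ⟨hD, (sharpBound_iff hr hs hd hh hH hD).2.2.2 hDh, (hd3 _ hD).2 ?_⟩
    rw [hy]
    -- With y₀ = s the claim is a difference of squares: (4s² + 5r²)² − (4s² − 3r²)² = 16r²(4s² +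
    -- r²).
    linear_combination
      ((4 * s ^ 2 - 3 * r ^ 2) * h + s * (4 * s ^ 2 + 5 * r ^ 2)) * hDh
  · rintro ⟨hD, h1, h2⟩
    have hDh := (sharpBound_iff hr hs hd hh hH hD).2.2.1 h1
    rw [hd3 _ hD, hy] at h2
    have hsy : s - y₀ = 0 := by
      have : 2 * s * (4 * s ^ 2 - 3 * r ^ 2) ^ 2 * (s - y₀) = 0 := by
        linear_combination h2 - ((4 * s ^ 2 - 3 * r ^ 2) * h + s * (4 * s ^ 2 + 5 * r ^ 2)) * hDh
      exact (mul_eq_zero.1 this).resolve_left (by positivity)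
    obtain rfl : s = y₀ := by linarith
    have hlt : 0 < h - s := by
      refine pos_of_mul_pos_left hD ?_
      have : 0 < r ^ 2 * s := by positivity
      linarith
    exact ⟨⟨by linarith, by linarith⟩, hsy, by linarith⟩

theorem region_S23_S31 :
    ((-h < y₀ ∧ y₀ < h) ∧ s - y₀ = 0 ∧
      0 < (4 * s ^ 2 - 3 * r ^ 2) * h + 4 * r ^ 2 * s - (4 * s ^ 2 + 9 * r ^ 2) * y₀) ↔
    (√3 / 2 * r < s ∧ sharpBound r s < d₁ ∧ d₃ = √(d₁ ^ 2 - r ^ 2 / 4 - s ^ 2)) := by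
  rw [sqrt_three_lt_iff hr hs, (sqrt_sub_iff hs hd₃ hH hy).2.2]
  have hrs : 0 < r ^ 2 * s := by positivity
  constructor
  · rintro ⟨-, h3, h4⟩
    obtain rfl : s = y₀ := by linarith
    have hD : 0 < 4 * s ^ 2 - 3 * r ^ 2 := by
      refine pos_of_mul_pos_left hh ?_
      have : 0 < s ^ 3 := by positivity
      linarith
    exact ⟨hD, (sharpBound_iff hr hs hd hh hH hD).1.2 (by linarith), h3⟩
  · rintro ⟨hD, h1, h3⟩
    have hDh := (sharpBound_iff hr hs hd hh hH hD).1.1 h1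
    obtain rfl : s = y₀ := by linarith
    have hlt : 0 < h - s := by
      refine pos_of_mul_pos_left hD ?_
      linarith
    exact ⟨⟨by linarith, by linarith⟩, h3, by linarith⟩

theorem region_S12_S23p_S31p :
    ((-h < y₀ ∧ y₀ < h) ∧ y₀ = 0 ∧
      (4 * s ^ 2 - 3 * r ^ 2) * h + 4 * r ^ 2 * s - (4 * s ^ 2 + 9 * r ^ 2) * y₀ = 0) ↔
    (s < √3 / 2 * r ∧ d₁ = flatBound r s ∧
        d₃ = s * √(25 * r ^ 4 - 24 * r ^ 2 * s ^ 2 + 16 * s ^ 4) / (3 * r ^ 2 - 4 * s ^ 2)) := by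
  rw [lt_sqrt_three_iff hr hs]
  have hK : 25 * r ^ 4 - 24 * r ^ 2 * s ^ 2 + 16 * s ^ 4
      = (3 * r ^ 2 - 4 * s ^ 2) ^ 2 + 16 * r ^ 4 := by ring
  have hd3 : ∀ E, 0 < E → (d₃ = s * √((3 * r ^ 2 - 4 * s ^ 2) ^ 2 + 16 * r ^ 4) / E ↔
      d₃ ^ 2 * E ^ 2 = s ^ 2 * ((3 * r ^ 2 - 4 * s ^ 2) ^ 2 + 16 * r ^ 4)) := by
    intro E hE
    rw [← sq_eq_sq₀ hd₃.le (by positivity), div_pow, mul_pow, Real.sq_sqrt (by positivity),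
      eq_div_iff (by positivity)]
  rw [hK]
  constructor
  · rintro ⟨-, rfl, h4⟩
    have hD : 4 * s ^ 2 - 3 * r ^ 2 < 0 := by
      have : 0 < -(4 * s ^ 2 - 3 * r ^ 2) := by
        refine pos_of_mul_pos_left hh ?_
        have : 0 < r ^ 2 * s := by positivity
        linarith
      linarith
    refine ⟨hD, (flatBound_iff hr hs hd hh hH hD).2.2.2 (by linarith), (hd3 _ (by linarith)).2 ?_⟩
    rw [hy]
    linear_combination ((4 * s ^ 2 - 3 * r ^ 2) * h - 4 * r ^ 2 * s) * h4
  · rintro ⟨hD, h1, h2⟩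
    have hDh := (flatBound_iff hr hs hd hh hH hD).2.2.1 h1
    rw [hd3 _ (by linarith), hy] at h2
    have hE : 0 < 3 * r ^ 2 - 4 * s ^ 2 := by linarith
    have hy0 : y₀ = 0 := by
      have : 2 * s * (3 * r ^ 2 - 4 * s ^ 2) ^ 2 * y₀ = 0 := by
        linear_combination ((4 * s ^ 2 - 3 * r ^ 2) * h - 4 * r ^ 2 * s) * hDh - h2
      exact (mul_eq_zero.1 this).resolve_left (by positivity)
    subst hy0
    exact ⟨⟨by linarith, hh⟩, rfl, by linarith⟩

theorem region_S12m_S23p_S31p :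
    ((-h < y₀ ∧ y₀ < h) ∧ y₀ < 0 ∧
      (4 * s ^ 2 - 3 * r ^ 2) * h + 4 * r ^ 2 * s + (4 * s ^ 2 + r ^ 2) * y₀ = 0) ↔
    ((s < √3 / 2 * r ∧ √(r ^ 2 / 4 + s ^ 2) < d₁ ∧ d₁ < flatBound r s ∧ d₃ = constM r s d₁) ∨
        (√3 / 2 * r ≤ s ∧ √(r ^ 2 / 4 + s ^ 2) < d₁ ∧ d₃ = constM r s d₁)) := by
  rw [← not_lt (a := s), lt_sqrt_three_iff hr hs, sqrt_lt_iff hd hs hh hH,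
    (constM_iff hr hs hd₃ hh hH hy).2, not_lt]
  have hα : 0 < 4 * s ^ 2 + r ^ 2 := by positivity
  have hr2 : 0 < 4 * r ^ 2 := by positivity
  constructor
  · rintro ⟨⟨h1, h2⟩, h3, h4⟩
    -- At y₀ = −h the expression in the tie condition equals 4r²(s − h), and it increases with y₀.
    have hlt : 0 < h - s := by
      refine pos_of_mul_pos_left hr2 ?_
      have := mul_pos hα (show 0 < y₀ + h by linarith)
      linarith
    rcases lt_or_ge (4 * s ^ 2 - 3 * r ^ 2) 0 with hD | hD
    · refine Or.inl ⟨hD, by linarith, (flatBound_iff hr hs hd hh hH hD).2.1.2 ?_, h4⟩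
      have := mul_pos hα (neg_pos.2 h3)
      linarith
    · exact Or.inr ⟨hD, by linarith, h4⟩
  · intro hR
    obtain ⟨hlt, hT, h4⟩ : s < h ∧ 0 < (4 * s ^ 2 - 3 * r ^ 2) * h + 4 * r ^ 2 * s ∧
        (4 * s ^ 2 - 3 * r ^ 2) * h + 4 * r ^ 2 * s + (4 * s ^ 2 + r ^ 2) * y₀ = 0 := by
      rcases hR with ⟨hD, h1, h2, h3⟩ | ⟨hD, h1, h3⟩
      · exact ⟨h1, (flatBound_iff hr hs hd hh hH hD).2.1.1 h2, h3⟩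
      · exact ⟨h1, by positivity, h3⟩
    have hneg : 0 < -y₀ := pos_of_mul_pos_left hα (by linarith)
    have hlo : 0 < y₀ + h := by
      refine pos_of_mul_pos_left hα ?_
      have := mul_pos hr2 (sub_pos.2 hlt)
      linarith
    exact ⟨⟨by linarith, by linarith⟩, by linarith, h4⟩

theorem region_S12p_S23m_S31m :
    ((-h < y₀ ∧ y₀ < h) ∧ s - y₀ < 0 ∧
      (4 * s ^ 2 + r ^ 2) * (h - y₀) - 4 * r ^ 2 * (s + h) = 0) ↔
    (√3 / 2 * r < s ∧ sharpBound r s < d₁ ∧ d₃ = dStar r s d₁) := by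
  rw [sqrt_three_lt_iff hr hs, (dStar_iff hr hs hd₃ hh hH hy).2]
  have hα : 0 < 4 * s ^ 2 + r ^ 2 := by positivity
  constructor
  · rintro ⟨-, h3, h4⟩
    have hlt := mul_pos hα (show 0 < y₀ - s by linarith)
    have hD : 0 < 4 * s ^ 2 - 3 * r ^ 2 := by
      refine pos_of_mul_pos_left hh ?_
      have : 0 < s ^ 3 := by positivity
      have : 0 < r ^ 2 * s := by positivity
      linarith
    exact ⟨hD, (sharpBound_iff hr hs hd hh hH hD).1.2 (by linarith), h4⟩
  · rintro ⟨hD, h1, h4⟩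
    have hDh := (sharpBound_iff hr hs hd hh hH hD).1.1 h1
    have hlt : 0 < y₀ - s := pos_of_mul_pos_left hα (by linarith)
    have hhi : 0 < h - y₀ := by
      refine pos_of_mul_pos_left hα ?_
      have : 0 < 4 * r ^ 2 * (s + h) := by positivity
      linarith
    exact ⟨⟨by linarith, by linarith⟩, by linarith, h4⟩

theorem region_S12p_S23p_S31p :
    ((-h < y₀ ∧ y₀ < h) ∧ 0 < y₀ ∧ 0 < s - y₀ ∧
      (4 * s ^ 2 - 3 * r ^ 2) * h + 4 * r ^ 2 * s - (4 * s ^ 2 + 9 * r ^ 2) * y₀ = 0) ↔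
    ((√(r ^ 2 / 4 + s ^ 2 / 9) < d₁ ∧ d₁ < √(r ^ 2 / 4 + s ^ 2) ∧ d₃ = constR r s d₁) ∨
        (s = √3 / 2 * r ∧ r ≤ d₁ ∧ d₃ = d₁) ∨
        (s < √3 / 2 * r ∧ √(r ^ 2 / 4 + s ^ 2) ≤ d₁ ∧ d₁ < flatBound r s ∧ d₃ = constR r s d₁) ∨
        (√3 / 2 * r < s ∧ √(r ^ 2 / 4 + s ^ 2) ≤ d₁ ∧ d₁ < sharpBound r s ∧
          d₃ = constR r s d₁)) := by
  rw [← not_lt (a := d₁) (b := √(r ^ 2 / 4 + s ^ 2)), sqrt_three_lt_iff hr hs,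
    lt_sqrt_three_iff hr hs, eq_sqrt_three_iff hr hs, lt_sqrt_iff hd hs hh hH,
    show s ^ 2 / 9 = (s / 3) ^ 2 by ring, sqrt_lt_iff hd (by positivity) hh hH,
    (constR_iff hr hs hd₃ hh hH hy).2, not_lt]
  have hα : 0 < 4 * s ^ 2 + 9 * r ^ 2 := by positivity
  have hr2 : 0 < r ^ 2 := by positivity
  have hs2 : 0 < s ^ 2 := by positivity
  have hrs : 0 < r ^ 2 * s := by positivity
  have hs3 : 0 < s ^ 3 := by positivity
  constructor
  · rintro ⟨⟨h1, h2⟩, h3, h4, h5⟩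
    have hlt : 0 < 3 * h - s := by
      refine pos_of_mul_pos_left hr2 ?_
      have := mul_pos hα (sub_pos.2 h2)
      linarith
    have hy0 := mul_pos hα h3
    rcases lt_or_ge h s with hhs | hhs
    · exact Or.inl ⟨by linarith, hhs, h5⟩
    rcases lt_trichotomy (4 * s ^ 2 - 3 * r ^ 2) 0 with hD | hD | hD
    · exact Or.inr (Or.inr (Or.inl ⟨hD, hhs,
        (flatBound_iff hr hs hd hh hH hD).2.1.2 (by linarith), h5⟩))
    -- In the equilateral case the tie forces y₀ = s/3, the height of the circumcentre, so all radii
    -- agree.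
    · refine Or.inr (Or.inl ⟨hD, ?_, ?_⟩)
      · rw [← pow_le_pow_iff_left₀ hr.le hd.le two_ne_zero]
        nlinarith
      · have hys : y₀ = s / 3 := by
          have : r ^ 2 * (3 * y₀ - s) = 0 := by
            linear_combination (h - y₀) / 4 * hD - (1 / 4 : ℝ) * h5
          have := (mul_eq_zero.1 this).resolve_left hr2.ne'
          linarith
        rw [← sq_eq_sq₀ hd₃.le hd.le, hy, hys]
        linarith
    · refine Or.inr (Or.inr (Or.inr ⟨hD, hhs,
        (sharpBound_iff hr hs hd hh hH hD).2.1.2 ?_, h5⟩))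
      have := mul_pos hα h4
      linarith
  · rintro (⟨h1, h2, h5⟩ | ⟨hD, h1, h2⟩ | ⟨hD, h1, h2, h5⟩ | ⟨hD, h1, h2, h5⟩)
    · have hy0 : 0 < y₀ := by
        refine pos_of_mul_pos_left hα ?_
        have := mul_pos hs2 hh
        have := mul_pos hr2 (sub_pos.2 h2)
        linarith
      have hhi : 0 < h - y₀ := by
        refine pos_of_mul_pos_left hα ?_
        have := mul_pos hr2 (sub_pos.2 h1)
        linarith
      exact ⟨⟨by linarith, by linarith⟩, hy0, by linarith, h5⟩
    · have hhs : s ≤ h := by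
        rw [← pow_le_pow_iff_left₀ hs.le hh.le two_ne_zero]
        have := pow_le_pow_left₀ hr.le h1 2
        linarith
      have hys : y₀ = s / 3 := by
        have : s * (3 * y₀ - s) = 0 := by
          rw [h2] at hy
          linear_combination (3 / 2 : ℝ) * hy - (3 / 2 : ℝ) * hH + (1 / 8 : ℝ) * hD
        have := (mul_eq_zero.1 this).resolve_left hs.ne'
        linarith
      subst hys
      exact ⟨⟨by linarith, by linarith⟩, by linarith, by linarith,
        by linear_combination (h - s / 3) * hD⟩
    · have hT := (flatBound_iff hr hs hd hh hH hD).2.1.1 h2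
      have hy0 : 0 < y₀ := pos_of_mul_pos_left hα (by linarith)
      have hsy : 0 < s - y₀ := by
        refine pos_of_mul_pos_left hα ?_
        have := mul_pos hh (neg_pos.2 hD)
        linarith
      exact ⟨⟨by linarith, by linarith⟩, hy0, hsy, h5⟩
    · have hT := (sharpBound_iff hr hs hd hh hH hD).2.1.1 h2
      have hy0 : 0 < y₀ := by
        refine pos_of_mul_pos_left hα ?_
        have := mul_pos hD hh
        linarith
      have hsy : 0 < s - y₀ := pos_of_mul_pos_left hα (by linarith)
      exact ⟨⟨by linarith, by linarith⟩, hy0, hsy, h5⟩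

theorem region_S12 :
    ((-h < y₀ ∧ y₀ < h) ∧ y₀ = 0 ∧
      (4 * s ^ 2 - 3 * r ^ 2) * h + 4 * r ^ 2 * s - (4 * s ^ 2 + 9 * r ^ 2) * y₀ < 0) ↔
    (s < √3 / 2 * r ∧ flatBound r s < d₁ ∧ d₃ = √(d₁ ^ 2 - r ^ 2 / 4 + s ^ 2)) := by
  rw [lt_sqrt_three_iff hr hs, eq_sqrt_add_iff hs hd₃ hH hy]
  constructor
  · rintro ⟨-, rfl, h4⟩
    have hD : 0 < -(4 * s ^ 2 - 3 * r ^ 2) := by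
      refine pos_of_mul_pos_left hh ?_
      have : 0 < r ^ 2 * s := by positivity
      linarith
    have hD' : 4 * s ^ 2 - 3 * r ^ 2 < 0 := by linarith
    exact ⟨hD', (flatBound_iff hr hs hd hh hH hD').1.2 (by linarith), rfl⟩
  · rintro ⟨hD, h1, rfl⟩
    have := (flatBound_iff hr hs hd hh hH hD).1.1 h1
    exact ⟨⟨by linarith, hh⟩, rfl, by linarith⟩

theorem region_S23m_S31m :
    ((-h < y₀ ∧ y₀ < h) ∧ s - y₀ < 0 ∧
      0 < (4 * s ^ 2 + r ^ 2) * (h - y₀) - 4 * r ^ 2 * (s + h)) ↔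
    (√3 / 2 * r < s ∧ sharpBound r s < d₁ ∧ dStar r s d₁ < d₃ ∧
      d₃ < √(d₁ ^ 2 - r ^ 2 / 4 - s ^ 2)) := by
  rw [sqrt_three_lt_iff hr hs, (dStar_iff hr hs hd₃ hh hH hy).1, (sqrt_sub_iff hs hd₃ hH hy).1]
  have hα : 0 < 4 * s ^ 2 + r ^ 2 := by positivity
  constructor
  · rintro ⟨-, h3, h4⟩
    have hlt := mul_pos hα (show 0 < y₀ - s by linarith)
    have hD : 0 < 4 * s ^ 2 - 3 * r ^ 2 := by
      refine pos_of_mul_pos_left hh ?_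
      have : 0 < s ^ 3 := by positivity
      have : 0 < r ^ 2 * s := by positivity
      linarith
    exact ⟨hD, (sharpBound_iff hr hs hd hh hH hD).1.2 (by linarith), h4, h3⟩
  · rintro ⟨hD, h1, h4, h3⟩
    have hhi : 0 < h - y₀ := by
      refine pos_of_mul_pos_left hα ?_
      have : 0 < 4 * r ^ 2 * (s + h) := by positivity
      linarith
    exact ⟨⟨by linarith, by linarith⟩, h3, h4⟩

theorem region_S23p_S31p :
    ((-h < y₀ ∧ y₀ < h) ∧ 0 < s - y₀ ∧
      0 < (4 * s ^ 2 - 3 * r ^ 2) * h + 4 * r ^ 2 * s - (4 * s ^ 2 + 9 * r ^ 2) * y₀ ∧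
      0 < (4 * s ^ 2 - 3 * r ^ 2) * h + 4 * r ^ 2 * s + (4 * s ^ 2 + r ^ 2) * y₀) ↔
    ((r / 2 < d₁ ∧ d₁ < √(r ^ 2 / 4 + s ^ 2 / 9) ∧
          s - √(d₁ ^ 2 - r ^ 2 / 4) < d₃ ∧ d₃ < s + √(d₁ ^ 2 - r ^ 2 / 4)) ∨
        (√(r ^ 2 / 4 + s ^ 2 / 9) ≤ d₁ ∧ d₁ ≤ √(r ^ 2 / 4 + s ^ 2) ∧
          constR r s d₁ < d₃ ∧ d₃ < s + √(d₁ ^ 2 - r ^ 2 / 4)) ∨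
        (s = √3 / 2 * r ∧ r < d₁ ∧
          constR r s d₁ < d₃ ∧ d₃ < √(d₁ ^ 2 + 2 * r ^ 2)) ∨
        (s < √3 / 2 * r ∧ √(r ^ 2 / 4 + s ^ 2) < d₁ ∧ d₁ < flatBound r s ∧
          constR r s d₁ < d₃ ∧ d₃ < constM r s d₁) ∨
        (√3 / 2 * r < s ∧ √(r ^ 2 / 4 + s ^ 2) < d₁ ∧
          max (constR r s d₁) (√(d₁ ^ 2 - r ^ 2 / 4 - s ^ 2)) < d₃ ∧
          d₃ < constM r s d₁)) := by
  rw [max_lt_iff, (sqrt_sub_iff hs hd₃ hH hy).2.1, ← not_lt (b := d₁), ← not_lt (a := d₁),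
    sqrt_three_lt_iff hr hs, lt_sqrt_three_iff hr hs, eq_sqrt_three_iff hr hs,
    sqrt_lt_iff hd hs hh hH, show s ^ 2 / 9 = (s / 3) ^ 2 by ring,
    lt_sqrt_iff hd (by positivity) hh hH, (constR_iff hr hs hd₃ hh hH hy).1,
    (constM_iff hr hs hd₃ hh hH hy).1, hH, Real.sqrt_sq hh.le, lt_add_iff hs hd₃ hh hy,
    Real.lt_sqrt hd₃.le, not_lt, not_lt]
  have hα : 0 < 4 * s ^ 2 + 9 * r ^ 2 := by positivity
  have hβ : 0 < 4 * s ^ 2 + r ^ 2 := by positivity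
  have hr2 : 0 < r ^ 2 := by positivity
  have hs2 : 0 < s ^ 2 := by positivity
  have hrs : 0 < r ^ 2 * s := by positivity
  have hs3 : 0 < s ^ 3 := by positivity
  have hrh : 0 < r ^ 2 * h := by positivity
  constructor
  · rintro ⟨⟨h1, h2⟩, h3, h4, h5⟩
    -- At y₀ = h the R-expression is 4r²(s − 3h), and at y₀ = −h the M-expression is 4r²(s − h).
    -- Hence h = s/3 and h = s are where these conditions begin to cut into −h < y₀ < h.
    rcases lt_or_ge h (s / 3) with hhs | hhs
    · refine Or.inl ⟨?_, hhs, ?_, h1⟩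
      · rw [← pow_lt_pow_iff_left₀ (by positivity) hd.le two_ne_zero]
        have := pow_pos hh 2
        linarith
      · have := (abs_sub_lt_iff hs hd₃ hy).2 h2
        linarith [neg_abs_le (h - s)]
    rcases le_or_gt h s with hhs' | hhs'
    · exact Or.inr (Or.inl ⟨hhs, hhs', h4, h1⟩)
    rcases lt_trichotomy (4 * s ^ 2 - 3 * r ^ 2) 0 with hD | hD | hD
    · refine Or.inr (Or.inr (Or.inr (Or.inl ⟨hD, hhs',
        (flatBound_iff hr hs hd hh hH hD).2.1.2 ?_, h4, h5⟩)))
      -- The factor is the sum of the two coefficients of y₀: cross-multiplying the R- and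
      -- M-conditions eliminates y₀.
      refine pos_of_mul_pos_left (show 0 < 8 * s ^ 2 + 10 * r ^ 2 by positivity) ?_
      have := mul_pos hα h5
      have := mul_pos hβ h4
      linarith
    · refine Or.inr (Or.inr (Or.inl ⟨hD, ?_, h4, ?_⟩))
      · rw [← pow_lt_pow_iff_left₀ hr.le hd.le two_ne_zero]
        nlinarith
      · have hys : 0 < s + y₀ := by
          refine pos_of_mul_pos_left hr2 ?_
          rw [hD] at h5
          have : 4 * s ^ 2 + r ^ 2 = 4 * r ^ 2 := by linarith
          rw [this] at h5
          linarith
        have := mul_pos hs hys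
        linarith
    · exact Or.inr (Or.inr (Or.inr (Or.inr ⟨hD, hhs', ⟨h4, h3⟩, h5⟩)))
  · rintro (⟨-, h1, h2, h3⟩ | ⟨h1, h2, h3, h4⟩ | ⟨hD, h1, h2, h3⟩ | ⟨hD, h1, h2, h3, h4⟩ |
      ⟨hD, h1, ⟨h2, h3⟩, h4⟩)
    · have hhi : y₀ < h := by
        rw [← abs_sub_lt_iff hs hd₃ hy, abs_of_nonpos (by linarith)]
        linarith
      have a1 := mul_pos hα (sub_pos.2 hhi)
      have a2 := mul_pos hr2 (show 0 < s - 3 * h by linarith)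
      have a3 := mul_pos hβ (show 0 < y₀ + h by linarith)
      exact ⟨⟨h3, hhi⟩, by linarith, by linarith, by linarith⟩
    · have hhi : 0 < h - y₀ := by
        refine pos_of_mul_pos_left hα ?_
        have := mul_nonneg hr2.le (sub_nonneg.2 h1)
        linarith
      have a3 := mul_pos hβ (show 0 < y₀ + h by linarith)
      have a4 := mul_nonneg hr2.le (sub_nonneg.2 h2)
      exact ⟨⟨h4, by linarith⟩, by linarith, h3, by linarith⟩
    · have hhs : s < h := by
        rw [← pow_lt_pow_iff_left₀ hs.le hh.le two_ne_zero]
        have := pow_lt_pow_left₀ h1 hr.le two_ne_zero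
        linarith
      have hys : 0 < s + y₀ := by
        refine pos_of_mul_pos_left hs ?_
        linarith
      have e1 : 4 * s ^ 2 + r ^ 2 = 4 * r ^ 2 := by linarith
      have e2 : 4 * s ^ 2 + 9 * r ^ 2 = 12 * r ^ 2 := by linarith
      have hsy : 0 < s - 3 * y₀ := by
        refine pos_of_mul_pos_left hr2 ?_
        rw [hD, e2] at h2
        linarith
      refine ⟨⟨by linarith, by linarith⟩, by linarith, h2, ?_⟩
      rw [hD, e1]
      have := mul_pos hr2 hys
      linarith
    · have hsy : 0 < s - y₀ := by
        refine pos_of_mul_pos_left hα ?_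
        have := mul_pos hh (neg_pos.2 hD)
        linarith
      have hlo : 0 < y₀ + h := by
        refine pos_of_mul_pos_left hβ ?_
        have := mul_pos hr2 (sub_pos.2 h1)
        linarith
      exact ⟨⟨by linarith, by linarith⟩, hsy, h3, h4⟩
    · have hlo : 0 < y₀ + h := by
        refine pos_of_mul_pos_left hβ ?_
        have := mul_pos hr2 (sub_pos.2 h1)
        linarith
      exact ⟨⟨by linarith, by linarith⟩, h3, h2, h4⟩

end Regions

/-! ### Well-definedness of d₃* and the classification -/

/-- In adapted coordinates the residuals of an isosceles configuration have a common quadratic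
part. -/
theorem exists_residual_coordinates {Z : Fin 3 → Plane} (hZ : AffineIndependent ℝ Z)
    (hiso : dist (Z 0) (Z 2) = dist (Z 1) (Z 2)) {r s : ℝ} (hr : r = dist (Z 0) (Z 1))
    (hs : s = dist (Z 2) (midpoint ℝ (Z 0) (Z 1))) :
    0 < r ∧ 0 < s ∧ ∃ φ : Plane ≃ ℝ × ℝ, ∀ {d : Fin 3 → ℝ} {d₁ d₃ H y₀ : ℝ}, d 0 = d₁ →
      d 1 = d₁ → d 2 = d₃ → d₁ ^ 2 - r ^ 2 / 4 = H → d₃ ^ 2 = H + s ^ 2 - 2 * s * y₀ →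
      (∀ W, dist W (Z 0) ^ 2 - d 0 ^ 2 = (φ W).1 ^ 2 + (φ W).2 ^ 2 - H + r * (φ W).1) ∧
      (∀ W, dist W (Z 1) ^ 2 - d 1 ^ 2 = (φ W).1 ^ 2 + (φ W).2 ^ 2 - H - r * (φ W).1) ∧
      (∀ W, dist W (Z 2) ^ 2 - d 2 ^ 2
        = (φ W).1 ^ 2 + (φ W).2 ^ 2 - H - 2 * s * ((φ W).2 - y₀)) := by
  obtain ⟨hr0, hs0, φ, hφ⟩ := exists_coordinates hZ hiso hr hs
  refine ⟨hr0, hs0, φ, ?_⟩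
  intro d d₁ d₃ H y₀ e0 e1 e2 eH ey
  subst eH
  refine ⟨fun W => ?_, fun W => ?_, fun W => ?_⟩
  · rw [(hφ W).1, e0]; ring
  · rw [(hφ W).2.1, e1]; ring
  · rw [(hφ W).2.2, e2, ey]; ring

theorem exists_half_height {r d₁ : ℝ} (hr : 0 < r) (hlt : r / 2 < d₁) :
    ∃ h, 0 < h ∧ d₁ ^ 2 - r ^ 2 / 4 = h ^ 2 := by
  have hpos : 0 < d₁ ^ 2 - r ^ 2 / 4 := by
    have := pow_lt_pow_left₀ hlt (by positivity) two_ne_zero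
    linarith
  exact ⟨√(d₁ ^ 2 - r ^ 2 / 4), Real.sqrt_pos.2 hpos, (Real.sq_sqrt hpos.le).symm⟩

theorem half_lt_sharpBound {r s : ℝ} (hr : 0 < r) (hs : 0 < s) (h : √3 / 2 * r < s) :
    r / 2 < sharpBound r s := by
  rw [sqrt_three_lt_iff hr hs] at h
  rw [sharpBound_eq]
  exact half_lt_sqrt hr (div_pos (by positivity) h)

theorem half_lt_flatBound {r s : ℝ} (hr : 0 < r) (hs : 0 < s) (h : s < √3 / 2 * r) :
    r / 2 < flatBound r s := by
  rw [lt_sqrt_three_iff hr hs] at h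
  rw [flatBound_eq]
  exact half_lt_sqrt hr (div_pos (by positivity) (by linarith))

theorem half_lt_sqrt_div {r s : ℝ} (hr : 0 < r) (hs : 0 < s) :
    r / 2 < √(r ^ 2 / 4 + s ^ 2 / 9) := by
  rw [show s ^ 2 / 9 = (s / 3) ^ 2 by ring]
  exact half_lt_sqrt hr (by positivity)

theorem dStarSpec {Z : Fin 3 → Plane} (hZ : AffineIndependent ℝ Z)
    (hiso : dist (Z 0) (Z 2) = dist (Z 1) (Z 2)) {r s d₁ : ℝ} (hr : r = dist (Z 0) (Z 1))
    (hs : s = dist (Z 2) (midpoint ℝ (Z 0) (Z 1))) (hd : 0 < d₁) (hsharp : √3 / 2 * r < s)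
    (hlt : sharpBound r s < d₁) : DStarSpec Z r s d₁ (dStar r s d₁) := by
  obtain ⟨hr0, hs0, φ, hφ⟩ := exists_residual_coordinates hZ hiso hr hs
  obtain ⟨h, hh, hH⟩ := exists_half_height hr0 ((half_lt_sharpBound hr0 hs0 hsharp).trans hlt)
  have hsh : s < h := by
    have hD := (sqrt_three_lt_iff hr0 hs0).1 hsharp
    have hDh := (sharpBound_iff hr0 hs0 hd hh hH hD).1.1 hlt
    have hrs : 0 < r ^ 2 * s := by positivity
    have : 0 < h - s := pos_of_mul_pos_left hD (by linarith)
    linarith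
  -- The third measurement is traded for the height y₀; the stated open interval then corresponds to
  -- s < y₀ < h.
  have level : ∀ x : ℝ, ∃ y₀, x ^ 2 = h ^ 2 + s ^ 2 - 2 * s * y₀ := fun x =>
    ⟨(h ^ 2 + s ^ 2 - x ^ 2) / (2 * s), by field_simp; ring⟩
  have hheight : √(d₁ ^ 2 - r ^ 2 / 4) = h := by rw [hH, Real.sqrt_sq hh.le]
  rw [DStarSpec, hheight]
  constructor
  · have hpos : 0 < dStar r s d₁ := by
      rw [dStar, hheight, Real.sqrt_pos]
      have : 0 < h - s := by linarith
      positivity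
    obtain ⟨y₀, hy⟩ := level (dStar r s d₁)
    obtain ⟨⟨h1, h2⟩, h3, -⟩ :=
      (region_S12p_S23m_S31m hr0 hs0 hd hpos hh hH hy).2 ⟨hsharp, hlt, rfl⟩
    refine ⟨?_, (sqrt_sub_iff hs0 hpos hH hy).1.2 h3⟩
    exact (le_abs_self _).trans_lt ((abs_sub_lt_iff hs0 hpos hy).2 h2)
  · rintro x ⟨hx1, hx2⟩
    have hx : 0 < x := by linarith
    obtain ⟨y₀, hy⟩ := level x
    have hsy := (sqrt_sub_iff hs0 hx hH hy).1.1 hx2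
    have hyh : y₀ < h := by
      rw [← abs_sub_lt_iff hs0 hx hy, abs_of_nonneg (by linarith)]
      exact hx1
    obtain ⟨k0, k1, k2⟩ := hφ (d := ![d₁, d₁, x]) (d₁ := d₁) (d₃ := x) rfl rfl rfl hH hy
    have hpos : ∀ i, 0 < ![d₁, d₁, x] i := by
      intro i
      fin_cases i <;> simpa
    obtain ⟨e, m, p, hm, hp, hsum, hprod, c⟩ := exists_vertexConfig hr0 hs0 hpos k0 k1 k2 hh rfl
      (sq_lt_sq' (by linarith) hyh)
    obtain ⟨-, -, -, -, -, hLS, -⟩ := value_signs hr0 hs0 (by linarith) hyh hm hp hsum hprod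
      rfl rfl rfl rfl rfl rfl
    rw [c.s23m, c.s12p, (dStar_iff hr0 hs0 hx hh hH hy).2, ← hLS]
    simp only [Set.mem_singleton_iff, exists_eq_left, c.val, Matrix.cons_val, sub_eq_zero]
    exact eq_comm

end GPS

open GPS in
theorem mainTheorem7 (Z : Fin 3 → GPS.Plane) (d : Fin 3 → ℝ) (r s d₁ d₃ : ℝ)
    (hZ : AffineIndependent ℝ Z)
    (hpos : ∀ i, 0 < d i)
    (hiso : dist (Z 0) (Z 2) = dist (Z 1) (Z 2))
    (hd₁ : d 0 = d₁) (hd₂ : d 1 = d₁) (hd₃ : d 2 = d₃)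
    (hr : r = dist (Z 0) (Z 1))
    (hs : s = dist (Z 2) (midpoint ℝ (Z 0) (Z 1))) :
    -- the constant `d₃*` is well defined
    (√3 / 2 * r < s → GPS.sharpBound r s < d₁ →
      GPS.DStarSpec Z r s d₁ (GPS.dStar r s d₁)) ∧
    -- `{S_12+, S_23±, S_31±}`
    (GPS.ConsistsOf (GPS.minimizers Z d)
        ![GPS.S12p Z d, GPS.S23p Z d, GPS.S23m Z d, GPS.S31p Z d, GPS.S31m Z d] ↔
      (√3 / 2 * r < s ∧ d₁ = GPS.sharpBound r s ∧
        d₃ = 4 * s * r / (4 * s ^ 2 - 3 * r ^ 2) * √(4 * s ^ 2 + r ^ 2))) ∧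
    -- `{S_23±, S_31±}`
    (GPS.ConsistsOf (GPS.minimizers Z d)
        ![GPS.S23p Z d, GPS.S23m Z d, GPS.S31p Z d, GPS.S31m Z d] ↔
      (√3 / 2 * r < s ∧ GPS.sharpBound r s < d₁ ∧
        d₃ = √(d₁ ^ 2 - r ^ 2 / 4 - s ^ 2))) ∧
    -- `{S_12±, S_23+, S_31+}`
    (GPS.ConsistsOf (GPS.minimizers Z d)
        ![GPS.S12p Z d, GPS.S12m Z d, GPS.S23p Z d, GPS.S31p Z d] ↔
      (s < √3 / 2 * r ∧ d₁ = GPS.flatBound r s ∧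
        d₃ = s * √(25 * r ^ 4 - 24 * r ^ 2 * s ^ 2 + 16 * s ^ 4) /
          (3 * r ^ 2 - 4 * s ^ 2))) ∧
    -- `{S_12-, S_23+, S_31+}`
    (GPS.ConsistsOf (GPS.minimizers Z d)
        ![GPS.S12m Z d, GPS.S23p Z d, GPS.S31p Z d] ↔
      ((s < √3 / 2 * r ∧ √(r ^ 2 / 4 + s ^ 2) < d₁ ∧ d₁ < GPS.flatBound r s ∧
          d₃ = GPS.constM r s d₁) ∨
        (√3 / 2 * r ≤ s ∧ √(r ^ 2 / 4 + s ^ 2) < d₁ ∧ d₃ = GPS.constM r s d₁))) ∧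
    -- `{S_12+, S_23-, S_31-}`
    (GPS.ConsistsOf (GPS.minimizers Z d)
        ![GPS.S12p Z d, GPS.S23m Z d, GPS.S31m Z d] ↔
      (√3 / 2 * r < s ∧ GPS.sharpBound r s < d₁ ∧ d₃ = GPS.dStar r s d₁)) ∧
    -- `{S_12+, S_23+, S_31+}`
    (GPS.ConsistsOf (GPS.minimizers Z d)
        ![GPS.S12p Z d, GPS.S23p Z d, GPS.S31p Z d] ↔
      ((√(r ^ 2 / 4 + s ^ 2 / 9) < d₁ ∧ d₁ < √(r ^ 2 / 4 + s ^ 2) ∧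
          d₃ = GPS.constR r s d₁) ∨
        (s = √3 / 2 * r ∧ r ≤ d₁ ∧ d₃ = d₁) ∨
        (s < √3 / 2 * r ∧ √(r ^ 2 / 4 + s ^ 2) ≤ d₁ ∧ d₁ < GPS.flatBound r s ∧
          d₃ = GPS.constR r s d₁) ∨
        (√3 / 2 * r < s ∧ √(r ^ 2 / 4 + s ^ 2) ≤ d₁ ∧ d₁ < GPS.sharpBound r s ∧
          d₃ = GPS.constR r s d₁))) ∧
    -- `{S_12±}`
    (GPS.ConsistsOf (GPS.minimizers Z d) ![GPS.S12p Z d, GPS.S12m Z d] ↔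
      (s < √3 / 2 * r ∧ GPS.flatBound r s < d₁ ∧
        d₃ = √(d₁ ^ 2 - r ^ 2 / 4 + s ^ 2))) ∧
    -- `{S_23-, S_31-}`
    (GPS.ConsistsOf (GPS.minimizers Z d) ![GPS.S23m Z d, GPS.S31m Z d] ↔
      (√3 / 2 * r < s ∧ GPS.sharpBound r s < d₁ ∧
        GPS.dStar r s d₁ < d₃ ∧ d₃ < √(d₁ ^ 2 - r ^ 2 / 4 - s ^ 2))) ∧
    -- `{S_23+, S_31+}`
    (GPS.ConsistsOf (GPS.minimizers Z d) ![GPS.S23p Z d, GPS.S31p Z d] ↔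
      ((r / 2 < d₁ ∧ d₁ < √(r ^ 2 / 4 + s ^ 2 / 9) ∧
          s - √(d₁ ^ 2 - r ^ 2 / 4) < d₃ ∧ d₃ < s + √(d₁ ^ 2 - r ^ 2 / 4)) ∨
        (√(r ^ 2 / 4 + s ^ 2 / 9) ≤ d₁ ∧ d₁ ≤ √(r ^ 2 / 4 + s ^ 2) ∧
          GPS.constR r s d₁ < d₃ ∧ d₃ < s + √(d₁ ^ 2 - r ^ 2 / 4)) ∨
        (s = √3 / 2 * r ∧ r < d₁ ∧
          GPS.constR r s d₁ < d₃ ∧ d₃ < √(d₁ ^ 2 + 2 * r ^ 2)) ∨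
        (s < √3 / 2 * r ∧ √(r ^ 2 / 4 + s ^ 2) < d₁ ∧ d₁ < GPS.flatBound r s ∧
          GPS.constR r s d₁ < d₃ ∧ d₃ < GPS.constM r s d₁) ∨
        (√3 / 2 * r < s ∧ √(r ^ 2 / 4 + s ^ 2) < d₁ ∧
          max (GPS.constR r s d₁) (√(d₁ ^ 2 - r ^ 2 / 4 - s ^ 2)) < d₃ ∧
          d₃ < GPS.constM r s d₁))) ∧
    -- these are all the cases in which the minimizer is not unique
    ((GPS.minimizers Z d).Nontrivial →
      GPS.ConsistsOf (GPS.minimizers Z d)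
        ![GPS.S12p Z d, GPS.S23p Z d, GPS.S23m Z d, GPS.S31p Z d, GPS.S31m Z d] ∨
      GPS.ConsistsOf (GPS.minimizers Z d)
        ![GPS.S23p Z d, GPS.S23m Z d, GPS.S31p Z d, GPS.S31m Z d] ∨
      GPS.ConsistsOf (GPS.minimizers Z d)
        ![GPS.S12p Z d, GPS.S12m Z d, GPS.S23p Z d, GPS.S31p Z d] ∨
      GPS.ConsistsOf (GPS.minimizers Z d)
        ![GPS.S12m Z d, GPS.S23p Z d, GPS.S31p Z d] ∨
      GPS.ConsistsOf (GPS.minimizers Z d)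
        ![GPS.S12p Z d, GPS.S23m Z d, GPS.S31m Z d] ∨
      GPS.ConsistsOf (GPS.minimizers Z d)
        ![GPS.S12p Z d, GPS.S23p Z d, GPS.S31p Z d] ∨
      GPS.ConsistsOf (GPS.minimizers Z d) ![GPS.S12p Z d, GPS.S12m Z d] ∨
      GPS.ConsistsOf (GPS.minimizers Z d) ![GPS.S23m Z d, GPS.S31m Z d] ∨
      GPS.ConsistsOf (GPS.minimizers Z d) ![GPS.S23p Z d, GPS.S31p Z d]) := by
  obtain ⟨hr0, hs0, φ, hφ⟩ := exists_residual_coordinates hZ hiso hr hs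
  have hd : 0 < d₁ := hd₁ ▸ hpos 0
  have hd3 : 0 < d₃ := hd₃ ▸ hpos 2
  refine ⟨fun h1 h2 => dStarSpec hZ hiso hr hs hd h1 h2, ?_⟩
  obtain ⟨H, hH⟩ : ∃ H, d₁ ^ 2 - r ^ 2 / 4 = H := ⟨_, rfl⟩
  obtain ⟨y₀, hy⟩ : ∃ y₀, d₃ ^ 2 = H + s ^ 2 - 2 * s * y₀ :=
    ⟨(H + s ^ 2 - d₃ ^ 2) / (2 * s), by field_simp; ring⟩
  obtain ⟨k0, k1, k2⟩ := hφ hd₁ hd₂ hd₃ hH hy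
  rcases le_or_gt H (y₀ ^ 2) with hout | hin
  · have hsub := minimizers_subsingleton hr0 hs0 k0 k1 k2 hout
    have hnt : ¬ (minimizers Z d).Nontrivial := Set.not_nontrivial_iff.2 hsub
    -- Every listed region forces d₁ > r/2, so h exists, and then |y₀| < h, contrary to H ≤ y₀².
    -- Both sides of each equivalence are therefore false.
    have outside : ∀ {P : ℝ → Prop} {Q : Prop}, (∀ h, 0 < h → d₁ ^ 2 - r ^ 2 / 4 = h ^ 2 →
        d₃ ^ 2 = h ^ 2 + s ^ 2 - 2 * s * y₀ → (((-h < y₀ ∧ y₀ < h) ∧ P h) ↔ Q)) →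
        (Q → r / 2 < d₁) → ¬ Q := by
      intro P Q hreg hhalf hQ
      obtain ⟨h, hh, hH'⟩ := exists_half_height hr0 (hhalf hQ)
      have hHh : H = h ^ 2 := hH.symm.trans hH'
      obtain ⟨⟨h1, h2⟩, -⟩ := (hreg h hh hH' (hHh ▸ hy)).2 hQ
      have := sq_lt_sq' h1 h2
      linarith
    have t1 := half_lt_sqrt hr0 hs0
    have t2 := half_lt_sqrt_div hr0 hs0
    have no : ∀ {n : ℕ} {A : Fin (n + 2) → Set Plane} {Q : Prop}, ¬ Q →
        (ConsistsOf (minimizers Z d) A ↔ Q) := fun hQ =>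
      iff_of_false (fun hc => hnt hc.nontrivial) hQ
    refine ⟨no (outside (fun h hh hH hy => region_S12p_S23_S31 hr0 hs0 hd hd3 hh hH hy)
        (fun ⟨h1, h2, _⟩ => h2 ▸ half_lt_sharpBound hr0 hs0 h1)),
      no (outside (fun h hh hH hy => region_S23_S31 hr0 hs0 hd hd3 hh hH hy)
        (fun ⟨h1, h2, _⟩ => (half_lt_sharpBound hr0 hs0 h1).trans h2)),
      no (outside (fun h hh hH hy => region_S12_S23p_S31p hr0 hs0 hd hd3 hh hH hy)
        (fun ⟨h1, h2, _⟩ => h2 ▸ half_lt_flatBound hr0 hs0 h1)),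
      no (outside (fun h hh hH hy => region_S12m_S23p_S31p hr0 hs0 hd hd3 hh hH hy) ?_),
      no (outside (fun h hh hH hy => region_S12p_S23m_S31m hr0 hs0 hd hd3 hh hH hy)
        (fun ⟨h1, h2, _⟩ => (half_lt_sharpBound hr0 hs0 h1).trans h2)),
      no (outside (fun h hh hH hy => region_S12p_S23p_S31p hr0 hs0 hd hd3 hh hH hy) ?_),
      no (outside (fun h hh hH hy => region_S12 hr0 hs0 hd hd3 hh hH hy)
        (fun ⟨h1, h2, _⟩ => (half_lt_flatBound hr0 hs0 h1).trans h2)),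
      no (outside (fun h hh hH hy => region_S23m_S31m hr0 hs0 hd hd3 hh hH hy)
        (fun ⟨h1, h2, _⟩ => (half_lt_sharpBound hr0 hs0 h1).trans h2)),
      no (outside (fun h hh hH hy => region_S23p_S31p hr0 hs0 hd hd3 hh hH hy) ?_),
      fun hX => absurd hX hnt⟩
    · rintro (⟨-, h1, -⟩ | ⟨-, h1, -⟩) <;> linarith
    · rintro (⟨h1, -⟩ | ⟨-, h1, -⟩ | ⟨-, h1, -⟩ | ⟨-, h1, -⟩) <;> linarith
    · rintro (⟨h1, -⟩ | ⟨h1, -⟩ | ⟨-, h1, -⟩ | ⟨-, h1, -⟩ | ⟨-, h1, -⟩) <;> linarith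
  · have hHpos : 0 < H := (sq_nonneg _).trans_lt hin
    obtain ⟨h, hh, rfl⟩ : ∃ h, 0 < h ∧ h ^ 2 = H :=
      ⟨√H, Real.sqrt_pos.2 hHpos, Real.sq_sqrt hHpos.le⟩
    obtain ⟨hlo, hhi⟩ := abs_lt_of_sq_lt_sq' hin hh.le
    obtain ⟨e, m, p, hm, hp, hsum, hprod, c⟩ :=
      exists_vertexConfig hr0 hs0 hpos k0 k1 k2 hh rfl hin
    obtain ⟨⟨a1, a2, a3⟩, ⟨b1, b2, b3⟩, ⟨c1, c2, c3⟩, ⟨-, m2, m3⟩, -, l2, l3⟩ :=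
      value_signs hr0 hs0 hlo hhi hm hp hsum hprod rfl rfl rfl rfl rfl rfl
    -- The hypothesis means y₀ ≥ s, hence y₀ > 0.
    have hord : 2 * r * p ≤ -(2 * r * m) → 2 * s * (h - y₀) < 2 * s * (h + y₀) := by
      intro hle
      have hsy : ¬ 0 < s - y₀ := fun hlt => by linarith [b3.2 hlt]
      linarith [a3.2 (by linarith)]
    obtain ⟨r1, r2, r3, r4, r5, r6, r7, r8, r9⟩ := c.consistsOf hord
    have inside : ∀ {P Q : Prop}, (((-h < y₀ ∧ y₀ < h) ∧ P) ↔ Q) → (P ↔ Q) := fun hPQ =>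
      ⟨fun hP => hPQ.1 ⟨⟨hlo, hhi⟩, hP⟩, fun hQ => (hPQ.2 hQ).2⟩
    refine ⟨r1.trans ?_, r2.trans ?_, r3.trans ?_, r4.trans ?_, r5.trans ?_, r6.trans ?_,
      r7.trans ?_, r8.trans ?_, r9.trans ?_, fun hX => ?_⟩
    · rw [b2, c2]; exact inside (region_S12p_S23_S31 hr0 hs0 hd hd3 hh hH hy)
    · rw [b2, c3]; exact inside (region_S23_S31 hr0 hs0 hd hd3 hh hH hy)
    · rw [a2, c2]; exact inside (region_S12_S23p_S31p hr0 hs0 hd hd3 hh hH hy)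
    · rw [a1, m2]; exact inside (region_S12m_S23p_S31p hr0 hs0 hd hd3 hh hH hy)
    · rw [b1, l2]; exact inside (region_S12p_S23m_S31m hr0 hs0 hd hd3 hh hH hy)
    · rw [a3, b3, c2]; exact inside (region_S12p_S23p_S31p hr0 hs0 hd hd3 hh hH hy)
    · rw [a2, c1]; exact inside (region_S12 hr0 hs0 hd hd3 hh hH hy)
    · rw [b1, l3]; exact inside (region_S23m_S31m hr0 hs0 hd hd3 hh hH hy)
    · rw [b3, c3, m3]; exact inside (region_S23p_S31p hr0 hs0 hd hd3 hh hH hy)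
    · rw [r1, r2, r3, r4, r5, r6, r7, r8, r9]
      exact c.pattern_of_nontrivial hord hX
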